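/- Fix $\lambda,\mu,P_b,P_u>0$, $\sigma_n^2\ge 0$, $\alpha_1,\alpha_2>2$, integers $M_b,M_u\ge 1$ and $\gamma_b,\gamma_u\ge 0$. For $i,j\in\{b,u\}$ put $G_i=\frac{M_i}{1+\gamma_i(M_i-1)}$, $H_i=\gamma_iG_i$, $$(\lambda_{i,j,k})_{k=1}^4=\tfrac{\lambda}{M_iM_j}\bigl(1,\;M_j-1,\;M_i-1,\;(M_i-1)(M_j-1)\bigr),\qquad (\Gamma_{i,j,k})_{k=1}^4=\bigl(G_iG_j,\;G_iH_j,\;G_jH_i,\;H_iH_j\bigr).$$ Let base stations $\Phi$ and uplink users $\Psi$ be independent homogeneous Poisson point processes of density $\lambda$ in $\mathbb{R}^2$. Each point of $\Phi$ independently falls into case $k\in\{1,2,3,4\}$ with probability $\lambda_{u,b,k}/\lambda$, giving the thinnings $\Phi_k$; each point of $\Psi$ independently falls into case $k$ with probability $\lambda_{u,u,k}/\lambda$, giving the thinnings $\Psi_k$. All links have independent fading powers which are exponential with mean $1/\mu$; point processes, cases and fadings are independent. A half-duplex downlink user at the origin, which suffers no loop interference, is served by the nearest base station $b_o$, at distance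 $r$, with link gain $\Gamma_{u,b,1}=G_uG_b$. Write $d_j,g_j$ for the distance and fading of base station $j$, $D_j,k_j$ for those of uplink user $j$, $h$ for the fading of the serving link, and $$I_b=P_b\sum_{i=1}^4\sum_{j\in\Phi_i\setminus b_o}\Gamma_{u,b,i}\,g_j d_j^{-\alpha_1},\qquad I_u=P_u\sum_{i=1}^4\sum_{j\in\Psi_i}\Gamma_{u,u,i}\,k_jD_j^{-\alpha_2},\qquad \mathrm{SINR}^d=\frac{P_b\Gamma_{u,b,1}hr^{-\alpha_1}}{\sigma_n^2+I_b+I_u}.$$ Let $R\ge 0$, $T=2^R-1$, $s=s(r)=\frac{\mu Tr^{\alpha_1}}{P_bG_bG_u}$, $c_i=\frac{\Gamma_{u,b,i}}{\Gamma_{u,b,1}}$, $q_i=\frac{\Gamma_{u,u,i}}{\Gamma_{u,b,1}}$. Then $I_b$ and $I_u$ are almost surely finite; the Laplace transform of $I_b$ at $s$, conditional on the serving distance $r$, and the Laplace transform of $I_u$ at $s$ are, respectively, $$\mathcal{L}_{I_b}(s)=\prod_{i=1}^4\exp\left(-2\pi\lambda_{u,b,i}\int_r^\infty\frac{c_iT}{c_iT+(x/r)^{\alpha_1}}\,x\,dx\right),$$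 $$\mathcal{L}_{I_u}(s)=\prod_{i=1}^4\exp\left(-2\pi\lambda_{u,u,i}\int_0^\infty\frac{\frac{P_u}{P_b}q_iT}{\frac{P_u}{P_b}q_iT+\frac{y^{\alpha_2}}{r^{\alpha_1}}}\,y\,dy\right);$$ and the outage probability $\Pi^d=\mathbb{P}[\log_2(1+\mathrm{SINR}^d)<R]$ is $$\Pi^d=1-2\pi\lambda\int_0^\infty r\,e^{-\lambda\pi r^2-s\sigma_n^2}\,\mathcal{L}_{I_b}(s)\,\mathcal{L}_{I_u}(s)\,dr.$$ -/

import Mathlib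

open MeasureTheory ProbabilityTheory Set
open scoped ENNReal NNReal BigOperators

/-- The Euclidean plane in which the network lives. -/
abbrev Plane : Type := EuclideanSpace ℝ (Fin 2)

section PoissonProcess

variable {Ω : Type*}

/-- The number of points of the enumerated random configuration `{X 0, X 1, …}` lying in `A`. -/
noncomputable def pointCount (X : ℕ → Ω → Plane) (A : Set Plane) (ω : Ω) : ℝ≥0∞ :=
  ∑' i, A.indicator (fun _ => (1 : ℝ≥0∞)) (X i ω)

/-- `{X 0, X 1, …}` is a homogeneous Poisson point process of density `lam` on the plane:
the number of points in a set `A` of finite area is Poisson distributed with mean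
`lam * area A`, and the numbers of points in finitely many disjoint sets are independent. -/
structure IsHomogeneousPPP [MeasurableSpace Ω] (P : Measure Ω) (lam : ℝ)
    (X : ℕ → Ω → Plane) : Prop where
  measurable : ∀ i, Measurable (X i)
  law_count : ∀ A : Set Plane, MeasurableSet A → volume A ≠ ∞ →
    HasLaw (pointCount X A)
      ((poissonMeasure (lam.toNNReal * (volume A).toNNReal)).map (Nat.cast : ℕ → ℝ≥0∞)) P
  indep_count : ∀ (n : ℕ) (A : Fin n → Set Plane), (∀ i, MeasurableSet (A i)) →
    (∀ i, volume (A i) ≠ ∞) → Pairwise (fun i j => Disjoint (A i) (A j)) →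
    iIndepFun (fun i => pointCount X (A i)) P

end PoissonProcess

/-- The two kinds of nodes: base stations and users. -/
inductive Node
  | bs
  | user

/-- The deterministic parameters of the network. -/
structure NetworkParams where
  /-- density of the base stations, and of the users -/
  lam : ℝ
  /-- the power of each channel fading is exponential with mean `1 / mu` -/
  mu : ℝ
  /-- path loss exponent between a base station and a user -/
  alpha1 : ℝ
  /-- path loss exponent between two base stations and between two users -/
  alpha2 : ℝ
  /-- transmit power of each kind of node (`P_b`, `P_u`) -/
  power : Node → ℝ
  /-- noise variance `σ_n²` -/
  noise : ℝ
  /-- number of directional antennas of each kind of node (`M_b`, `M_u`) -/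
  antennas : Node → ℕ
  /-- ratio of side lobe level to main lobe level (`γ_b`, `γ_u`) -/
  lobeRatio : Node → ℝ
  lam_pos : 0 < lam
  mu_pos : 0 < mu
  two_lt_alpha1 : 2 < alpha1
  two_lt_alpha2 : 2 < alpha2
  power_pos : ∀ i, 0 < power i
  noise_nonneg : 0 ≤ noise
  one_le_antennas : ∀ i, 1 ≤ antennas i
  lobeRatio_nonneg : ∀ i, 0 ≤ lobeRatio i

namespace NetworkParams

/-- Main lobe gain `G_i = M_i / (1 + γ_i (M_i - 1))`. -/
noncomputable def mainGain (p : NetworkParams) (i : Node) : ℝ :=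
  (p.antennas i : ℝ) / (1 + p.lobeRatio i * ((p.antennas i : ℝ) - 1))

/-- Side lobe gain `H_i = γ_i G_i`. -/
noncomputable def sideGain (p : NetworkParams) (i : Node) : ℝ :=
  p.lobeRatio i * p.mainGain i

/-- Densities `λ_{i,j,k}` of the four thinnings of the interferers of kind `j` seen by a receiver
of kind `i`; the four cases are indexed by `0, 1, 2, 3`. -/
noncomputable def thinDensity (p : NetworkParams) (i j : Node) : Fin 4 → ℝ :=
  let Mi : ℝ := p.antennas i
  let Mj : ℝ := p.antennas j
  ![p.lam / (Mi * Mj),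
    p.lam * (Mj - 1) / (Mi * Mj),
    p.lam * (Mi - 1) / (Mi * Mj),
    p.lam * (Mi - 1) * (Mj - 1) / (Mi * Mj)]

/-- Power gains `Γ_{i,j,k}` of the link from a transmitter of kind `j` to a receiver of kind `i`
in the four cases. -/
noncomputable def linkGain (p : NetworkParams) (i j : Node) : Fin 4 → ℝ :=
  ![p.mainGain i * p.mainGain j,
    p.mainGain i * p.sideGain j,
    p.mainGain j * p.sideGain i,
    p.sideGain i * p.sideGain j]

end NetworkParams

/-- The random network as seen by the typical downlink user, located at the origin, in the
three-node architecture. -/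
structure DownlinkNetwork {Ω : Type*} [MeasurableSpace Ω] (P : Measure Ω)
    (p : NetworkParams) where
  /-- locations of the base stations -/
  bsLoc : ℕ → Ω → Plane
  /-- locations of the uplink users -/
  userLoc : ℕ → Ω → Plane
  /-- fading of the link from the serving base station -/
  fading : Ω → ℝ
  /-- fading of the interfering link from each base station -/
  bsFading : ℕ → Ω → ℝ
  /-- fading of the interfering link from each uplink user -/
  userFading : ℕ → Ω → ℝ
  /-- directional case in which each base station interferes -/
  bsCase : ℕ → Ω → Fin 4
  /-- directional case in which each uplink user interferes -/
  userCase : ℕ → Ω → Fin 4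
  ppp_bs : IsHomogeneousPPP P p.lam bsLoc
  ppp_user : IsHomogeneousPPP P p.lam userLoc
  measurable_fading : Measurable fading
  measurable_bsFading : ∀ j, Measurable (bsFading j)
  measurable_userFading : ∀ j, Measurable (userFading j)
  measurable_bsCase : ∀ j, Measurable (bsCase j)
  measurable_userCase : ∀ j, Measurable (userCase j)
  law_fading : HasLaw fading (expMeasure p.mu) P
  law_bsFading : ∀ j, HasLaw (bsFading j) (expMeasure p.mu) P
  law_userFading : ∀ j, HasLaw (userFading j) (expMeasure p.mu) P
  /-- A base station falls into case `k` with probability `λ_{u,b,k} / λ`, so that the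
  base stations in case `k` form a thinning of density `λ_{u,b,k}`. -/
  law_bsCase : ∀ j k,
    P {ω | bsCase j ω = k} = ENNReal.ofReal (p.thinDensity .user .bs k / p.lam)
  /-- An uplink user falls into case `k` with probability `λ_{u,u,k} / λ`. -/
  law_userCase : ∀ j k,
    P {ω | userCase j ω = k} = ENNReal.ofReal (p.thinDensity .user .user k / p.lam)
  indep_bsFading : iIndepFun bsFading P
  indep_userFading : iIndepFun userFading P
  indep_bsCase : iIndepFun bsCase P
  indep_userCase : iIndepFun userCase P
  /-- The two point processes, the fadings and the directional cases are independent. -/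
  indep : iIndep
    ![MeasurableSpace.comap (fun ω j => bsLoc j ω) inferInstance,
      MeasurableSpace.comap (fun ω j => userLoc j ω) inferInstance,
      MeasurableSpace.comap fading inferInstance,
      MeasurableSpace.comap (fun ω j => bsFading j ω) inferInstance,
      MeasurableSpace.comap (fun ω j => userFading j ω) inferInstance,
      MeasurableSpace.comap (fun ω j => bsCase j ω) inferInstance,
      MeasurableSpace.comap (fun ω j => userCase j ω) inferInstance] P

namespace DownlinkNetwork

variable {Ω : Type*} [MeasurableSpace Ω] {P : Measure Ω} {p : NetworkParams}

/-- Index of the serving base station: the one nearest to the origin (the first one in the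
enumeration, should several be nearest). -/
noncomputable def serving (N : DownlinkNetwork P p) (ω : Ω) : ℕ :=
  sInf {i : ℕ | ∀ j, ‖N.bsLoc i ω‖ ≤ ‖N.bsLoc j ω‖}

/-- Distance `r` to the serving base station. -/
noncomputable def servingDist (N : DownlinkNetwork P p) (ω : Ω) : ℝ :=
  ‖N.bsLoc (N.serving ω) ω‖

/-- Interference `I_b` from all base stations other than the serving one. Each inner sum is over
the interfering base stations in case `k`. -/
noncomputable def bsInterference (N : DownlinkNetwork P p) (ω : Ω) : ℝ≥0∞ :=
  ENNReal.ofReal (p.power .bs) *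
    ∑ k : Fin 4, ∑' j : {j : ℕ // N.bsCase j ω = k ∧ j ≠ N.serving ω},
      ENNReal.ofReal (p.linkGain .user .bs k * N.bsFading j ω) *
        ‖N.bsLoc j ω‖ₑ ^ (-p.alpha1)

/-- Interference `I_u` from all uplink users. Each inner sum is over the uplink users in
case `k`. -/
noncomputable def userInterference (N : DownlinkNetwork P p) (ω : Ω) : ℝ≥0∞ :=
  ENNReal.ofReal (p.power .user) *
    ∑ k : Fin 4, ∑' j : {j : ℕ // N.userCase j ω = k},
      ENNReal.ofReal (p.linkGain .user .user k * N.userFading j ω) *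
        ‖N.userLoc j ω‖ₑ ^ (-p.alpha2)

/-- Signal-to-interference-plus-noise ratio of the half-duplex downlink user (there is no loop
interference); the serving link has the gain of case 1. -/
noncomputable def sinr (N : DownlinkNetwork P p) (ω : Ω) : ℝ≥0∞ :=
  ENNReal.ofReal (p.power .bs * p.linkGain .user .bs 0 * N.fading ω) *
      ENNReal.ofReal (N.servingDist ω) ^ (-p.alpha1) /
    (ENNReal.ofReal p.noise + N.bsInterference ω + N.userInterference ω)

/-- Achievable rate `log₂ (1 + SINR)`, in bits per channel use. -/
noncomputable def rate (N : DownlinkNetwork P p) (ω : Ω) : EReal :=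
  ENNReal.log (1 + N.sinr ω) / ((Real.log 2 : ℝ) : EReal)

/-- Outage probability of the downlink user for the target rate `R`. -/
noncomputable def outage (N : DownlinkNetwork P p) (R : ℝ) : ℝ :=
  P.real {ω | N.rate ω < (R : EReal)}

end DownlinkNetwork

namespace NetworkParams

/-- The SINR threshold `T = 2 ^ R - 1`. -/
noncomputable def threshold (R : ℝ) : ℝ := (2 : ℝ) ^ R - 1

/-- The argument `s = μ T r ^ α₁ / (P_b G_b G_u)` of the Laplace transforms. -/
noncomputable def sArg (p : NetworkParams) (R r : ℝ) : ℝ :=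
  p.mu * threshold R * r ^ p.alpha1 / (p.power .bs * p.mainGain .bs * p.mainGain .user)

/-- `c_i = Γ_{u,b,i} / Γ_{u,b,1}`. -/
noncomputable def cRatio (p : NetworkParams) (i : Fin 4) : ℝ :=
  p.linkGain .user .bs i / p.linkGain .user .bs 0

/-- `q_i = Γ_{u,u,i} / Γ_{u,b,1}`. -/
noncomputable def qRatio (p : NetworkParams) (i : Fin 4) : ℝ :=
  p.linkGain .user .user i / p.linkGain .user .bs 0

/-- The explicit product for the base station interference, at serving distance `r`. -/
noncomputable def bsProduct (p : NetworkParams) (R r : ℝ) : ℝ :=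
  ∏ i : Fin 4, Real.exp (-(2 * Real.pi * p.thinDensity .user .bs i *
    ∫ x in Ioi r, p.cRatio i * threshold R /
      (p.cRatio i * threshold R + (x / r) ^ p.alpha1) * x))

/-- The explicit product for the uplink user interference, at serving distance `r`. -/
noncomputable def userProduct (p : NetworkParams) (R r : ℝ) : ℝ :=
  ∏ i : Fin 4, Real.exp (-(2 * Real.pi * p.thinDensity .user .user i *
    ∫ y in Ioi (0 : ℝ), (p.power .user / p.power .bs) * p.qRatio i * threshold R /
      ((p.power .user / p.power .bs) * p.qRatio i * threshold R +
        y ^ p.alpha2 / r ^ p.alpha1) * y))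

end NetworkParams

/-! The rate is below `R` exactly when the fading `h` of the serving link is below `(s/μ)(σ² + I_b +
I_u)`, with `s = s(r)`. Since `h` is exponential of rate `μ` and independent of everything else, the
complementary probability is the mean of `exp (-s(σ² + I_b + I_u))`. Outage is thus a matter of
Laplace transforms at `s(r)` and of the law of the serving distance `r`.

All transforms are written with `expNeg`, the function `e^{-x}` on `[0, ∞]` with `e^{-∞} = 0`. It is
continuous, bounded by 1 and turns sums into products, so random series can be handled before they
are known to converge. Its inverse `negLog` writes an infinite product of numbers in `[0, 1]` as
`expNeg` of a series. With positions fixed, averaging over the independent fadings and then over the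
independent cases (`integral_mul_expNeg_marks`) therefore gives `expNeg` of a sum over the points of
a deterministic function of position, whose factor is `thinLaplace`.

The uplink users then follow from the Laplace functional of a Poisson process, `E exp (-∑ φ(X_i)) =
exp (-λ ∫ (1 - e^{-φ}))` (`IsHomogeneousPPP.integral_expNeg_tsum`), which is proved from independent
Poisson counts for simple functions and extended by monotone limits. The integral is linear in the
case probabilities, whence one exponential factor per case.

For the base stations the nearest point is removed and the weights depend on its distance `D`.
Conditioning is replaced by differentiation: let `H(t)` be the mean of the functional of the
remaining points on `{D ≤ t}`. On `{t < D ≤ u}` that functional is at most the one of the points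
beyond `u` with parameter `t`, and at least the one with parameter `u`, unless the annulus holds two
points, an event of probability `O((u - t)²)`. Both comparison terms come from the Laplace
functional, with weight `∞` on a disk to force it to be empty. Squeezing gives the right derivative
`nearestDensity` of `H`, hence the joint law in `integral_nearestDist_mul_expNeg`. Tested against
indicators of `D` it yields the conditional Laplace transform; tested against the noise and user
factors it yields the outage probability. -/

open Filter Topology

/-! ### The exponential `e^{-x}` on `[0, ∞]` and its inverse -/

/-- The function `x ↦ exp (-x)` on `[0, ∞]`. -/
noncomputable def expNeg (x : ℝ≥0∞) : ℝ := if x = ∞ then 0 else Real.exp (-x.toReal)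

/-- The function `y ↦ -log y` on `[0, 1]`, with values in `[0, ∞]`. -/
noncomputable def negLog (y : ℝ) : ℝ≥0∞ := if y ≤ 0 then ∞ else ENNReal.ofReal (-Real.log y)

@[simp] lemma expNeg_top : expNeg ∞ = 0 := by simp [expNeg]

@[simp] lemma expNeg_zero : expNeg 0 = 1 := by simp [expNeg]

lemma expNeg_of_ne_top {x : ℝ≥0∞} (hx : x ≠ ∞) : expNeg x = Real.exp (-x.toReal) := by
  simp [expNeg, hx]

lemma expNeg_ofReal {a : ℝ} (ha : 0 ≤ a) : expNeg (ENNReal.ofReal a) = Real.exp (-a) := by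
  rw [expNeg_of_ne_top ENNReal.ofReal_ne_top, ENNReal.toReal_ofReal ha]

lemma expNeg_ofReal_mul {a : ℝ} (ha : 0 ≤ a) {x : ℝ≥0∞} (hx : x ≠ ∞) :
    expNeg (ENNReal.ofReal a * x) = Real.exp (-(a * x.toReal)) := by
  rw [expNeg_of_ne_top (ENNReal.mul_ne_top ENNReal.ofReal_ne_top hx), ENNReal.toReal_mul,
    ENNReal.toReal_ofReal ha]

lemma expNeg_nonneg (x : ℝ≥0∞) : 0 ≤ expNeg x := by
  unfold expNeg; split_ifs <;> positivity

lemma expNeg_pos {x : ℝ≥0∞} (hx : x ≠ ∞) : 0 < expNeg x := by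
  rw [expNeg_of_ne_top hx]; positivity

lemma expNeg_le_one (x : ℝ≥0∞) : expNeg x ≤ 1 := by
  unfold expNeg; split_ifs <;> simp

lemma norm_expNeg_le_one (x : ℝ≥0∞) : ‖expNeg x‖ ≤ 1 := by
  rw [Real.norm_of_nonneg (expNeg_nonneg x)]; exact expNeg_le_one x

lemma expNeg_add (x y : ℝ≥0∞) : expNeg (x + y) = expNeg x * expNeg y := by
  by_cases hx : x = ∞
  · simp [hx]
  by_cases hy : y = ∞
  · simp [hy]
  rw [expNeg_of_ne_top hx, expNeg_of_ne_top hy, expNeg_of_ne_top (by simp [hx, hy]),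
    ENNReal.toReal_add hx hy, ← Real.exp_add]
  ring_nf

lemma expNeg_sum {ι : Type*} (s : Finset ι) (f : ι → ℝ≥0∞) :
    expNeg (∑ i ∈ s, f i) = ∏ i ∈ s, expNeg (f i) := by
  classical
  induction s using Finset.induction_on with
  | empty => simp
  | insert a s ha ih => rw [Finset.sum_insert ha, Finset.prod_insert ha, expNeg_add, ih]

lemma expNeg_mul_natCast (a : ℝ≥0∞) (n : ℕ) : expNeg (a * n) = expNeg a ^ n := by
  induction n with
  | zero => simp
  | succ n ih => rw [Nat.cast_succ, mul_add, mul_one, expNeg_add, ih, pow_succ]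

lemma expNeg_antitone : Antitone expNeg := by
  intro x y hxy
  obtain ⟨c, rfl⟩ := exists_add_of_le hxy
  rw [expNeg_add]
  exact mul_le_of_le_one_right (expNeg_nonneg x) (expNeg_le_one c)

lemma expNeg_eq_toReal_exp (x : ℝ≥0∞) : expNeg x = (EReal.exp (-(x : EReal))).toReal := by
  by_cases hx : x = ∞
  · simp [hx]
  · lift x to ℝ≥0 using hx
    rw [expNeg_of_ne_top (by simp)]
    have : (-((x : ℝ≥0∞) : EReal)) = ((-(x : ℝ) : ℝ) : EReal) := by simp; rfl
    rw [this, EReal.exp_coe, ENNReal.toReal_ofReal (Real.exp_nonneg _)]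
    simp

lemma continuous_expNeg : Continuous expNeg := by
  rw [continuous_iff_continuousAt]
  intro x
  have h : expNeg = fun x : ℝ≥0∞ => (EReal.exp (-(x : EReal))).toReal :=
    funext expNeg_eq_toReal_exp
  rw [h]
  refine (ENNReal.tendsto_toReal ?_).comp
    ((ENNReal.continuous_exp.comp (continuous_neg.comp continuous_coe_ennreal_ereal)).tendsto x)
  simp [EReal.neg_eq_top_iff]

@[fun_prop] lemma measurable_expNeg : Measurable expNeg := continuous_expNeg.measurable

/-- The value `∞` of `negLog` at `0` matches `expNeg ∞ = 0`, so vanishing factors of a product need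
no separate treatment. -/
lemma expNeg_negLog {y : ℝ} (h0 : 0 ≤ y) (h1 : y ≤ 1) : expNeg (negLog y) = y := by
  unfold negLog
  split_ifs with h
  · simp [le_antisymm h h0]
  · rw [expNeg_ofReal (by linarith [Real.log_nonpos h0 h1]), neg_neg, Real.exp_log (by linarith)]

lemma negLog_antitone : Antitone negLog := by
  intro x y hxy
  unfold negLog
  split_ifs with h1 h2 h2
  · exact le_rfl
  · exact absurd (hxy.trans h1) h2
  · exact le_top
  · exact ENNReal.ofReal_le_ofReal (neg_le_neg (Real.log_le_log (by linarith) hxy))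

@[fun_prop] lemma measurable_negLog : Measurable negLog :=
  Measurable.ite measurableSet_Iic measurable_const (by fun_prop)

lemma integrable_expNeg {Ω : Type*} [MeasurableSpace Ω] {P : Measure Ω} [IsFiniteMeasure P]
    {f : Ω → ℝ≥0∞} (hf : AEMeasurable f P) : Integrable (fun ω => expNeg (f ω)) P :=
  Integrable.of_bound (measurable_expNeg.comp_aemeasurable hf).aestronglyMeasurable 1
    (ae_of_all _ fun _ => norm_expNeg_le_one _)

/-- Dominated convergence with the constant 1; the limit `g` may take the value `∞`. -/
lemma tendsto_integral_expNeg {Ω : Type*} [MeasurableSpace Ω] {P : Measure Ω} [IsFiniteMeasure P]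
    {f : ℕ → Ω → ℝ≥0∞} {g : Ω → ℝ≥0∞} (hf : ∀ n, AEMeasurable (f n) P)
    (h : ∀ᵐ ω ∂P, Tendsto (fun n => f n ω) atTop (𝓝 (g ω))) :
    Tendsto (fun n => ∫ ω, expNeg (f n ω) ∂P) atTop (𝓝 (∫ ω, expNeg (g ω) ∂P)) := by
  refine tendsto_integral_of_dominated_convergence (fun _ => (1 : ℝ))
    (fun n => (integrable_expNeg (hf n)).aestronglyMeasurable) (integrable_const _)
    (fun n => ae_of_all _ fun _ => norm_expNeg_le_one _) ?_
  filter_upwards [h] with ω hω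
  exact (continuous_expNeg.tendsto _).comp hω

/-! ### Laplace transforms of independent series and of Poisson variables -/

/-- Laplace transform of a series of functions of independent random variables. -/
lemma integral_expNeg_tsum_of_iIndepFun {Ω β : Type*} [MeasurableSpace Ω] [MeasurableSpace β]
    {P : Measure Ω} [IsProbabilityMeasure P] {U : ℕ → Ω → β} (hU : ∀ j, Measurable (U j))
    (hind : iIndepFun U P) {φ : ℕ → β → ℝ≥0∞} (hφ : ∀ j, Measurable (φ j)) :
    ∫ ω, expNeg (∑' j, φ j (U j ω)) ∂P
      = expNeg (∑' j, negLog (∫ ω, expNeg (φ j (U j ω)) ∂P)) := by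
  have h0 : ∀ j, 0 ≤ ∫ ω, expNeg (φ j (U j ω)) ∂P :=
    fun j => integral_nonneg fun _ => expNeg_nonneg _
  have h1 : ∀ j, ∫ ω, expNeg (φ j (U j ω)) ∂P ≤ 1 := fun j => by
    simpa using integral_mono (integrable_expNeg (P := P) ((hφ j).comp (hU j)).aemeasurable)
      (integrable_const (1 : ℝ)) (fun ω => expNeg_le_one (φ j (U j ω)))
  -- Independence factorises the partial sums; the product of means is stored as `expNeg` of a sum
  -- so that the limit in `n` can be taken on both sides.
  have hfin : ∀ n, ∫ ω, expNeg (∑ j ∈ Finset.range n, φ j (U j ω)) ∂P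
      = expNeg (∑ j ∈ Finset.range n, negLog (∫ ω, expNeg (φ j (U j ω)) ∂P)) := by
    intro n
    simp_rw [expNeg_sum, expNeg_negLog (h0 _) (h1 _)]
    have hi : iIndepFun (fun (i : Fin n) ω => U i ω) P := hind.precomp Fin.val_injective
    have := hi.integral_fun_prod_comp (f := fun i : Fin n => fun u => expNeg (φ i u))
      (fun i => (hU i).aemeasurable)
      (fun i => (measurable_expNeg.comp (hφ i)).aestronglyMeasurable)
    simp_rw [Finset.prod_range]
    exact this
  have hl := tendsto_integral_expNeg (P := P) (f := fun n ω => ∑ j ∈ Finset.range n, φ j (U j ω))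
    (g := fun ω => ∑' j, φ j (U j ω))
    (fun n => (Finset.measurable_sum _ fun j _ => (hφ j).comp (hU j)).aemeasurable)
    (ae_of_all _ fun ω => ENNReal.tendsto_nat_tsum _)
  simp_rw [hfin] at hl
  exact tendsto_nhds_unique hl ((continuous_expNeg.tendsto _).comp (ENNReal.tendsto_nat_tsum _))

/-- This is the generating function `E z^N = exp (-m(1 - z))` at `z = e^{-a}`. The case `a = ∞`,
where `z = 0`, is the probability of no point. -/
lemma integral_expNeg_mul_poisson (a : ℝ≥0∞) (m : ℝ≥0) :
    ∫ n, expNeg (a * n) ∂(poissonMeasure m) = Real.exp (-(m * (1 - expNeg a))) := by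
  rw [integral_poissonMeasure]
  simp_rw [expNeg_mul_natCast, smul_eq_mul]
  have h : ∀ n : ℕ, Real.exp (-m) * (m : ℝ) ^ n / n.factorial * expNeg a ^ n
      = Real.exp (-m) * ((m * expNeg a) ^ n / n.factorial) := fun n => by
    rw [mul_pow]; ring
  simp_rw [h]
  rw [tsum_mul_left, (NormedSpace.expSeries_div_hasSum_exp ((m : ℝ) * expNeg a)).tsum_eq,
    ← Real.exp_eq_exp_ℝ, ← Real.exp_add]
  ring_nf

lemma lintegral_natCast_poisson (m : ℝ≥0) : ∫⁻ n, (n : ℝ≥0∞) ∂(poissonMeasure m) = m := by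
  rw [poissonMeasure, lintegral_sum_measure]
  simp_rw [lintegral_smul_measure, lintegral_dirac, smul_eq_mul]
  -- As `n / n! = 1 / (n-1)!`, dropping the zero term and shifting leaves `m` times the total mass.
  have hs : HasSum (fun n : ℕ => Real.exp (-m) * (m : ℝ) ^ n / n.factorial * n) m := by
    rw [← hasSum_nat_add_iff' 1]
    have h := (hasSum_one_poissonMeasure m).mul_left (m : ℝ)
    simp only [mul_one] at h
    simp only [Finset.range_one, Finset.sum_singleton, Nat.cast_zero, mul_zero, sub_zero]
    refine h.congr_fun fun n => ?_
    rw [Nat.factorial_succ]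
    push_cast
    field_simp
    ring
  have h2 : ∀ n : ℕ, ENNReal.ofReal (Real.exp (-m) * (m : ℝ) ^ n / n.factorial) * (n : ℝ≥0∞)
      = ENNReal.ofReal (Real.exp (-m) * (m : ℝ) ^ n / n.factorial * n) := fun n => by
    rw [ENNReal.ofReal_mul (by positivity), ENNReal.ofReal_natCast]
  simp_rw [h2]
  rw [← ENNReal.ofReal_tsum_of_nonneg (fun n => by positivity) hs.summable, hs.tsum_eq,
    ENNReal.ofReal_coe_nnreal]

/-! ### Intensity measure and Laplace functional of a Poisson process -/

section Configuration

variable {Ω : Type*}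

/-- The counting measure of the enumerated configuration. -/
noncomputable def configMeasure (X : ℕ → Ω → Plane) (ω : Ω) : Measure Plane :=
  Measure.sum fun i => Measure.dirac (X i ω)

lemma lintegral_configMeasure (X : ℕ → Ω → Plane) (ω : Ω) {φ : Plane → ℝ≥0∞}
    (hφ : Measurable φ) : ∫⁻ x, φ x ∂(configMeasure X ω) = ∑' i, φ (X i ω) := by
  rw [configMeasure, lintegral_sum_measure]
  simp_rw [lintegral_dirac' _ hφ]

lemma configMeasure_apply (X : ℕ → Ω → Plane) (ω : Ω) {A : Set Plane} (hA : MeasurableSet A) :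
    configMeasure X ω A = pointCount X A ω := by
  rw [configMeasure, Measure.sum_apply _ hA]
  simp_rw [Measure.dirac_apply' _ hA]
  rfl

end Configuration

namespace IsHomogeneousPPP

variable {Ω : Type*} [MeasurableSpace Ω] {P : Measure Ω} {lam : ℝ}
  {X : ℕ → Ω → Plane}

lemma measurable_tsum (hX : IsHomogeneousPPP P lam X) {φ : Plane → ℝ≥0∞} (hφ : Measurable φ) :
    Measurable fun ω => ∑' i, φ (X i ω) :=
  Measurable.tsum fun i => hφ.comp (hX.measurable i)

lemma measurable_pointCount (hX : IsHomogeneousPPP P lam X) {A : Set Plane}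
    (hA : MeasurableSet A) : Measurable (pointCount X A) :=
  hX.measurable_tsum (measurable_const.indicator hA)

lemma coe_mean (lam : ℝ) {A : Set Plane} (hv : volume A ≠ ∞) :
    ((lam.toNNReal * (volume A).toNNReal : ℝ≥0) : ℝ≥0∞) = ENNReal.ofReal lam * volume A := by
  rw [ENNReal.coe_mul, ENNReal.coe_toNNReal hv]; rfl

/-- The Laplace functional for `φ = a · 1_A`, with the exponent already in the form `λ ∫ (1 -
e^{-φ})`. -/
lemma integral_expNeg_pointCount (hX : IsHomogeneousPPP P lam X) {A : Set Plane}
    (hA : MeasurableSet A) (hv : volume A ≠ ∞) (a : ℝ≥0∞) :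
    ∫ ω, expNeg (a * pointCount X A ω) ∂P
      = expNeg (ENNReal.ofReal lam * (ENNReal.ofReal (1 - expNeg a) * volume A)) := by
  have h := (hX.law_count A hA hv).integral_comp (f := fun x => expNeg (a * x))
    (Measurable.aestronglyMeasurable (by fun_prop))
  simp only [Function.comp_def] at h
  rw [h, integral_map (by fun_prop) (Measurable.aestronglyMeasurable (by fun_prop)), integral_expNeg_mul_poisson,
    mul_left_comm, ← coe_mean lam hv, expNeg_ofReal_mul (by linarith [expNeg_le_one a]) ENNReal.coe_ne_top]
  congr 2
  simp [mul_comm]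

lemma lintegral_pointCount (hX : IsHomogeneousPPP P lam X) {A : Set Plane}
    (hA : MeasurableSet A) (hv : volume A ≠ ∞) :
    ∫⁻ ω, pointCount X A ω ∂P = ENNReal.ofReal lam * volume A := by
  have h := (hX.law_count A hA hv).lintegral_comp (f := fun x => x) (by fun_prop)
  rw [h, lintegral_map (by fun_prop) (by fun_prop), lintegral_natCast_poisson, coe_mean lam hv]

/-- The probability is `1 - e^{-m}(1 + m)`, and `e^{-m} ≥ 1 - m` bounds it by `1 - (1 - m)(1 + m) =
m²`. The quadratic order makes two points in a thin annulus negligible when differentiating. -/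
lemma measureReal_two_le_pointCount_le [IsProbabilityMeasure P] (hX : IsHomogeneousPPP P lam X)
    {A : Set Plane} (hA : MeasurableSet A) (hv : volume A ≠ ∞) :
    P.real {ω | ¬ pointCount X A ω ≤ 1} ≤ (ENNReal.ofReal lam * volume A).toReal ^ 2 := by
  set m := lam.toNNReal * (volume A).toNNReal with hm
  have hms : MeasurableSet {x : ℝ≥0∞ | x ≤ 1} := measurableSet_Iic
  have h1 : P.real {ω | pointCount X A ω ≤ 1} = Real.exp (-m) * (1 + m) := by
    have h := (hX.law_count A hA hv).measureReal_eq (p := fun x => x ≤ 1) hms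
    rw [h, map_measureReal_apply (by fun_prop) hms]
    have : (Nat.cast ⁻¹' {x : ℝ≥0∞ | x ≤ 1} : Set ℕ) = (({0, 1} : Finset ℕ) : Set ℕ) := by
      ext n
      simp only [mem_preimage, mem_ofPred_eq, Nat.cast_le_one, Finset.coe_insert,
        Finset.coe_singleton, mem_insert_iff, mem_singleton_iff]
      omega
    rw [this, ← sum_measureReal_singleton, Finset.sum_pair (by norm_num),
      poissonMeasure_real_singleton, poissonMeasure_real_singleton]
    simp only [pow_zero, pow_one, Nat.factorial, Nat.cast_one, ← hm]
    ring
  have hms' : MeasurableSet {ω | pointCount X A ω ≤ 1} :=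
    hX.measurable_pointCount hA measurableSet_Iic
  have h2 : P.real {ω | ¬ pointCount X A ω ≤ 1} = 1 - P.real {ω | pointCount X A ω ≤ 1} :=
    probReal_compl_eq_one_sub hms'
  rw [h2, h1, ← coe_mean lam hv, ENNReal.coe_toReal]
  have hexp := Real.add_one_le_exp (-(m : ℝ))
  have hm0 : (0 : ℝ) ≤ m := m.2
  nlinarith

/-- The intensity measure is a multiple of the Lebesgue measure. -/
lemma sum_map_eq (hX : IsHomogeneousPPP P lam X) :
    Measure.sum (fun i => P.map (X i)) = ENNReal.ofReal lam • volume := by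
  have key : ∀ A : Set Plane, MeasurableSet A → volume A ≠ ∞ →
      Measure.sum (fun i => P.map (X i)) A = (ENNReal.ofReal lam • volume) A := by
    intro A hA hv
    rw [Measure.sum_apply _ hA, Measure.smul_apply, smul_eq_mul, ← hX.lintegral_pointCount hA hv]
    unfold pointCount
    have hm : ∀ i, AEMeasurable (fun ω => A.indicator (fun _ => (1 : ℝ≥0∞)) (X i ω)) P := fun i =>
      ((measurable_const.indicator hA).comp (hX.measurable i)).aemeasurable
    rw [lintegral_tsum hm]
    refine tsum_congr fun i => ?_
    rw [Measure.map_apply (hX.measurable i) hA, ← lintegral_indicator_one ((hX.measurable i) hA)]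
    rfl
  ext A hA
  -- Counts are controlled only on sets of finite area, so `A` is exhausted by its intersections
  -- with balls.
  have hU : A = ⋃ n : ℕ, A ∩ Metric.ball (0 : Plane) n := by
    rw [← inter_iUnion, Metric.iUnion_ball_nat, inter_univ]
  have hmono : Monotone fun n : ℕ => A ∩ Metric.ball (0 : Plane) n := fun i j hij =>
    inter_subset_inter_right _ (Metric.ball_subset_ball (by exact_mod_cast hij))
  rw [hU, hmono.measure_iUnion, hmono.measure_iUnion]
  refine iSup_congr fun n => key _ (hA.inter measurableSet_ball) ?_
  exact ((measure_mono inter_subset_right).trans_lt measure_ball_lt_top).ne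

/-- Campbell's formula. -/
lemma lintegral_tsum_eq (hX : IsHomogeneousPPP P lam X) {φ : Plane → ℝ≥0∞} (hφ : Measurable φ) :
    ∑' i, ∫⁻ ω, φ (X i ω) ∂P = ENNReal.ofReal lam * ∫⁻ x, φ x := by
  rw [← smul_eq_mul, ← lintegral_smul_measure, ← hX.sum_map_eq, lintegral_sum_measure]
  exact tsum_congr fun i => (lintegral_map hφ (hX.measurable i)).symm

lemma ae_notMem (hX : IsHomogeneousPPP P lam X) {A : Set Plane} (hA : volume A = 0) :
    ∀ᵐ ω ∂P, ∀ i, X i ω ∉ A := by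
  rw [ae_all_iff]
  intro i
  have h0 : Measure.sum (fun i => P.map (X i)) A = 0 := by rw [hX.sum_map_eq]; simp [hA]
  have h1 : P.map (X i) A = 0 := le_antisymm ((Measure.le_sum_apply _ _).trans'
    (ENNReal.le_tsum i) |>.trans h0.le) zero_le
  exact ae_of_ae_map (hX.measurable i).aemeasurable (measure_eq_zero_iff_ae_notMem.1 h1)

lemma ae_pointCount_lt_top (hX : IsHomogeneousPPP P lam X) {A : Set Plane}
    (hA : MeasurableSet A) (hv : volume A ≠ ∞) : ∀ᵐ ω ∂P, pointCount X A ω < ∞ := by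
  refine ae_lt_top (hX.measurable_pointCount hA) ?_
  rw [hX.lintegral_pointCount hA hv]
  exact ENNReal.mul_ne_top ENNReal.ofReal_ne_top hv

/-- The sum over points is a finite combination of counts on the fibres of `f`. These are disjoint,
so the counts are independent and the mean factorises. -/
lemma integral_expNeg_simpleFunc [IsProbabilityMeasure P] (hX : IsHomogeneousPPP P lam X)
    (f : SimpleFunc Plane ℝ≥0∞) (hf : volume (Function.support f) ≠ ∞) :
    ∫ ω, expNeg (∑' i, f (X i ω)) ∂P
      = expNeg (ENNReal.ofReal lam * ∫⁻ x, ENNReal.ofReal (1 - expNeg (f x))) := by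
  classical
  -- The fibre over 0 contributes nothing and may have infinite area, so it is left out.
  set s := f.range.filter (· ≠ 0) with hs
  have hs0 : ∀ y ∈ s, y ≠ 0 := fun y hy => (Finset.mem_filter.1 hy).2
  have hfin : ∀ y ∈ s, volume (f ⁻¹' {y}) ≠ ∞ := fun y hy =>
    ((measure_mono fun x (hx : f x = y) => by
      rw [Function.mem_support, hx]; exact hs0 y hy).trans_lt hf.lt_top).ne
  let e := s.equivFin
  let A : Fin s.card → Set Plane := fun i => f ⁻¹' {((e.symm i : s) : ℝ≥0∞)}
  have hAm : ∀ i, MeasurableSet (A i) := fun i => f.measurableSet_fiber _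
  have hAv : ∀ i, volume (A i) ≠ ∞ := fun i => hfin _ (e.symm i).2
  have hAd : Pairwise fun i j => Disjoint (A i) (A j) := fun i j hij => by
    refine Disjoint.preimage f ?_
    rw [disjoint_singleton]
    exact fun h => hij (e.symm.injective (Subtype.ext h))
  have hsum : ∀ ω, ∑' i, f (X i ω)
      = ∑ i : Fin s.card, ((e.symm i : s) : ℝ≥0∞) * pointCount X (A i) ω := by
    intro ω
    rw [← lintegral_configMeasure X ω f.measurable, SimpleFunc.lintegral_eq_lintegral,
      SimpleFunc.lintegral]
    rw [← Finset.sum_filter_of_ne (p := (· ≠ 0)) (fun x _ h hx => h (by simp [hx])), ← hs,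
      ← Finset.sum_coe_sort, ← e.symm.sum_comp]
    exact Finset.sum_congr rfl fun i _ => by rw [configMeasure_apply _ _ (hAm i)]
  have hint : ∫⁻ x, ENNReal.ofReal (1 - expNeg (f x))
      = ∑ i : Fin s.card, ENNReal.ofReal (1 - expNeg (e.symm i : s)) * volume (A i) := by
    have : ∀ x, ENNReal.ofReal (1 - expNeg (f x))
      = (f.map fun y => ENNReal.ofReal (1 - expNeg y)) x := fun x => rfl
    simp_rw [this]
    rw [SimpleFunc.lintegral_eq_lintegral, SimpleFunc.map_lintegral,
      ← Finset.sum_filter_of_ne (p := (· ≠ 0)) (fun x _ h hx => h (by simp [hx])), ← hs,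
      ← Finset.sum_coe_sort, ← e.symm.sum_comp]
  simp_rw [hsum, hint, Finset.mul_sum, expNeg_sum]
  have hi := (hX.indep_count _ A hAm hAv hAd).integral_fun_prod_comp
    (f := fun i x => expNeg (((e.symm i : s) : ℝ≥0∞) * x))
    (fun i => (hX.measurable_pointCount (hAm i)).aemeasurable)
    (fun i => Measurable.aestronglyMeasurable (by fun_prop))
  rw [hi]
  exact Finset.prod_congr rfl fun i _ => hX.integral_expNeg_pointCount (hAm i) (hAv i) _

/-- The Laplace functional of a homogeneous Poisson point process. -/
lemma integral_expNeg_tsum [IsProbabilityMeasure P] (hX : IsHomogeneousPPP P lam X)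
    {φ : Plane → ℝ≥0∞} (hφ : Measurable φ) :
    ∫ ω, expNeg (∑' i, φ (X i ω)) ∂P
      = expNeg (ENNReal.ofReal lam * ∫⁻ x, ENNReal.ofReal (1 - expNeg (φ x))) := by
  -- Restricting the increasing simple approximations to growing balls gives supports of finite area
  -- and keeps monotonicity.
  let f : ℕ → SimpleFunc Plane ℝ≥0∞ :=
    fun n => (SimpleFunc.eapprox φ n).restrict (Metric.ball 0 n)
  have happ : ∀ n x, f n x = (Metric.ball (0 : Plane) n).indicator (SimpleFunc.eapprox φ n) x :=
    fun n x => SimpleFunc.restrict_apply _ measurableSet_ball x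
  have hmono : ∀ x, Monotone fun n => f n x := by
    intro x i j hij
    simp only [happ]
    refine (indicator_le_indicator (SimpleFunc.monotone_eapprox φ hij x)).trans ?_
    exact indicator_le_indicator_of_subset (Metric.ball_subset_ball (by exact_mod_cast hij))
      (fun _ => zero_le) x
  have hlim : ∀ x, Tendsto (fun n => f n x) atTop (𝓝 (φ x)) := by
    intro x
    refine (SimpleFunc.tendsto_eapprox hφ x).congr' ?_
    obtain ⟨N, hN⟩ := exists_nat_gt ‖x‖
    filter_upwards [eventually_ge_atTop N] with n hn
    rw [happ, indicator_of_mem]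
    rw [mem_ball_zero_iff]
    exact hN.trans_le (by exact_mod_cast hn)
  have hsupp : ∀ n, volume (Function.support (f n)) ≠ ∞ := fun n => by
    refine ((measure_mono ?_).trans_lt (measure_ball_lt_top (x := (0 : Plane)) (r := n))).ne
    intro x hx
    by_contra h
    exact hx (by rw [happ, indicator_of_notMem h])
  have h1 := tendsto_integral_expNeg (P := P) (f := fun n ω => ∑' i, f n (X i ω))
    (g := fun ω => ∑' i, φ (X i ω))
    (fun n => (hX.measurable_tsum (f n).measurable).aemeasurable)
    (ae_of_all _ fun ω => by
      -- Sums over points are integrals against the counting measure, so monotone convergence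
      -- applies for each configuration.
      simp_rw [← lintegral_configMeasure X ω (f _).measurable,
        ← lintegral_configMeasure X ω hφ]
      exact lintegral_tendsto_of_tendsto_of_monotone (fun n => (f n).measurable.aemeasurable)
        (ae_of_all _ hmono) (ae_of_all _ hlim))
  simp_rw [hX.integral_expNeg_simpleFunc (f _) (hsupp _)] at h1
  refine tendsto_nhds_unique h1 ((continuous_expNeg.tendsto _).comp
    (ENNReal.Tendsto.const_mul ?_ (Or.inr ENNReal.ofReal_ne_top)))
  refine lintegral_tendsto_of_tendsto_of_monotone
    (fun n => by have := (f n).measurable; fun_prop) (ae_of_all _ fun x i j hij => ?_)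
    (ae_of_all _ fun x => ?_)
  · exact ENNReal.ofReal_le_ofReal (sub_le_sub_left (expNeg_antitone (hmono x hij)) 1)
  · exact (ENNReal.continuous_ofReal.tendsto _).comp
      (((continuous_expNeg.tendsto _).comp (hlim x)).const_sub 1)

end IsHomogeneousPPP

/-! ### The nearest point of a sequence and its measurability -/

/-- Index of the point of a sequence which is nearest to the origin. -/
noncomputable def nearest (x : ℕ → Plane) : ℕ := sInf {i | ∀ j, ‖x i‖ ≤ ‖x j‖}

/-- Distance from the origin to the nearest point of a sequence. -/
noncomputable def nearestDist (x : ℕ → Plane) : ℝ := ‖x (nearest x)‖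

/-- The sum of `ψ r` over all points of a sequence but the nearest one, which lies at
distance `r` from the origin. -/
noncomputable def sumBeyondNearest (ψ : ℝ → Plane → ℝ≥0∞) (x : ℕ → Plane) : ℝ≥0∞ :=
  ∑' j, if j = nearest x then 0 else ψ (nearestDist x) (x j)

lemma measurable_nearest : Measurable nearest := by
  have hS : ∀ n, MeasurableSet {x : ℕ → Plane | ∀ j, ‖x n‖ ≤ ‖x j‖} := fun n => by
    have : {x : ℕ → Plane | ∀ j, ‖x n‖ ≤ ‖x j‖} = ⋂ j, {x : ℕ → Plane | ‖x n‖ ≤ ‖x j‖} := by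
      ext x; simp
    rw [this]
    exact MeasurableSet.iInter fun j => measurableSet_le (by fun_prop) (by fun_prop)
  refine measurable_of_Iic fun n => ?_
  -- A sequence without a point of minimal norm has index `sInf ∅ = 0`, which lies in every `Iic n`;
  -- hence the complement.
  have : nearest ⁻¹' Iic n = (⋃ i ∈ Iic n, {x : ℕ → Plane | ∀ j, ‖x i‖ ≤ ‖x j‖}) ∪
      (⋃ i, {x : ℕ → Plane | ∀ j, ‖x i‖ ≤ ‖x j‖})ᶜ := by
    ext x
    simp only [mem_preimage, mem_Iic, mem_union, mem_iUnion, mem_ofPred_eq, exists_prop,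
      mem_compl_iff, nearest]
    constructor
    · intro h
      by_cases hne : {i | ∀ j, ‖x i‖ ≤ ‖x j‖}.Nonempty
      · exact Or.inl ⟨_, h, Nat.sInf_mem hne⟩
      · exact Or.inr fun ⟨i, hi⟩ => hne ⟨i, hi⟩
    · rintro (⟨i, hi, hx⟩ | h)
      · exact (Nat.sInf_le (show i ∈ {i | ∀ j, ‖x i‖ ≤ ‖x j‖} from hx)).trans hi
      · rw [show {i | ∀ j, ‖x i‖ ≤ ‖x j‖} = ∅ from
          eq_empty_of_forall_notMem fun i hi => h ⟨i, hi⟩]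
        simp
  rw [this]
  exact ((MeasurableSet.biUnion (to_countable _) fun i _ => hS i)).union
    (MeasurableSet.iUnion hS).compl

lemma measurable_nearestDist : Measurable nearestDist := by
  have h : Measurable fun p : (ℕ → Plane) × ℕ => ‖p.1 p.2‖ :=
    measurable_from_prod_countable_left fun n => measurable_norm.comp (measurable_pi_apply n)
  change Measurable ((fun p : (ℕ → Plane) × ℕ => ‖p.1 p.2‖) ∘ fun x => (x, nearest x))
  exact h.comp (measurable_id.prodMk measurable_nearest)

lemma measurable_sumBeyondNearest {ψ : ℝ → Plane → ℝ≥0∞} (hψ : Measurable (Function.uncurry ψ)) :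
    Measurable (sumBeyondNearest ψ) := by
  refine Measurable.tsum fun j => Measurable.ite ?_ measurable_const ?_
  · exact measurableSet_eq_fun measurable_const measurable_nearest
  · exact hψ.comp (measurable_nearestDist.prodMk (measurable_pi_apply j))

lemma nearestDist_nonneg (x : ℕ → Plane) : 0 ≤ nearestDist x := norm_nonneg _

section PointCount

variable {Ω : Type*} {X : ℕ → Ω → Plane} {A : Set Plane} {ω : Ω}

lemma eq_of_pointCount_le_one (h : pointCount X A ω ≤ 1) {i j : ℕ} (hi : X i ω ∈ A)
    (hj : X j ω ∈ A) : i = j := by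
  by_contra hij
  have h2 : (1 : ℝ≥0∞) + 1 ≤ pointCount X A ω := by
    have := ENNReal.sum_le_tsum (f := fun i => A.indicator (fun _ => (1 : ℝ≥0∞)) (X i ω)) {i, j}
    rw [Finset.sum_pair hij, indicator_of_mem hi, indicator_of_mem hj] at this
    exact this
  have h3 := h2.trans h
  norm_num at h3

lemma finite_of_pointCount_lt_top (h : pointCount X A ω < ∞) : {i | X i ω ∈ A}.Finite := by
  refine (ENNReal.finite_const_le_of_tsum_ne_top (ε := 1) h.ne one_ne_zero).subset fun i hi => ?_
  simp only [mem_ofPred_eq] at hi ⊢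
  rw [indicator_of_mem hi]

end PointCount

/-! ### Two-sided estimates when the nearest point lies in a thin annulus -/

/-- `∫ (1 - exp (-ψ a x)) dx` over the points `x` with `b < ‖x‖`. -/
noncomputable def tailIntegral (ψ : ℝ → Plane → ℝ≥0∞) (b a : ℝ) : ℝ≥0∞ :=
  ∫⁻ x in {x : Plane | b < ‖x‖}, ENNReal.ofReal (1 - expNeg (ψ a x))

lemma measurableSet_lt_norm (b : ℝ) : MeasurableSet {x : Plane | b < ‖x‖} :=
  measurableSet_lt measurable_const measurable_norm

lemma measurable_tailIntegral_diag {ψ : ℝ → Plane → ℝ≥0∞}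
    (hψ : Measurable (Function.uncurry ψ)) : Measurable fun u => tailIntegral ψ u u := by
  unfold tailIntegral
  simp_rw [← lintegral_indicator (measurableSet_lt_norm _)]
  have h : Measurable fun p : ℝ × Plane =>
      {p : ℝ × Plane | p.1 < ‖p.2‖}.indicator
        (fun p => ENNReal.ofReal (1 - expNeg (Function.uncurry ψ p))) p :=
    Measurable.indicator (by fun_prop) (measurableSet_lt (by fun_prop) (by fun_prop))
  exact h.lintegral_prod_right'

/-- Dominated convergence as `u ↓ t`: by monotonicity the integrand with parameter `a u ≤ u < t + 1`
is below the one with parameter `t + 1`. The free parameter `a u` serves both the upper bound (`a u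
= t`) and the lower bound (`a u = u`). -/
lemma tendsto_tailIntegral {ψ : ℝ → Plane → ℝ≥0∞} (hψ : Measurable (Function.uncurry ψ))
    (hmono : ∀ x a b, 0 ≤ a → a ≤ b → ψ a x ≤ ψ b x)
    {t : ℝ} (ht : 0 < t)
    (hcont : ∀ x : Plane, x ≠ 0 → ContinuousAt (fun a => expNeg (ψ a x)) t)
    (hfin : tailIntegral ψ t (t + 1) ≠ ∞) {a : ℝ → ℝ}
    (ha : Tendsto a (𝓝[>] t) (𝓝 t)) (ha0 : ∀ u, t < u → 0 ≤ a u) (ha1 : ∀ u, t < u → a u ≤ u) :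
    Tendsto (fun u => tailIntegral ψ u (a u)) (𝓝[>] t) (𝓝 (tailIntegral ψ t t)) := by
  unfold tailIntegral at hfin ⊢
  simp_rw [← lintegral_indicator (measurableSet_lt_norm _)] at hfin ⊢
  have hm : ∀ a, Measurable (ψ a) := fun a => hψ.comp measurable_prodMk_left
  refine tendsto_lintegral_filter_of_dominated_convergence _
    (Eventually.of_forall fun u => Measurable.indicator (by have := hm (a u); fun_prop)
      (measurableSet_lt_norm _)) ?_ hfin ?_
  · filter_upwards [Ioo_mem_nhdsGT (show t < t + 1 by linarith)] with u hu
    refine ae_of_all _ fun x => ?_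
    refine (indicator_le_indicator_of_subset (fun x (hx : u < ‖x‖) => hu.1.trans hx)
      (fun _ => zero_le) x).trans (indicator_le_indicator ?_)
    exact ENNReal.ofReal_le_ofReal (sub_le_sub_left (expNeg_antitone
      (hmono x _ _ (ha0 u hu.1) ((ha1 u hu.1).trans hu.2.le))) 1)
  · refine ae_of_all _ fun x => ?_
    by_cases hx : t < ‖x‖
    · have hx0 : x ≠ 0 := norm_pos_iff.1 (ht.trans hx)
      rw [indicator_of_mem (show x ∈ {x : Plane | t < ‖x‖} from hx)]
      refine Tendsto.congr' (f₁ := fun u => ENNReal.ofReal (1 - expNeg (ψ (a u) x))) ?_ ?_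
      · filter_upwards [Ioo_mem_nhdsGT hx] with u hu
        rw [indicator_of_mem (show x ∈ {x : Plane | u < ‖x‖} from hu.2)]
      · exact (ENNReal.continuous_ofReal.tendsto _).comp
          (((hcont x hx0).tendsto.comp ha).const_sub 1)
    · rw [indicator_of_notMem (show x ∉ {x : Plane | t < ‖x‖} from hx)]
      refine Tendsto.congr' (f₁ := fun _ => 0) ?_ tendsto_const_nhds
      filter_upwards [self_mem_nhdsWithin] with u hu
      rw [indicator_of_notMem (show x ∉ {x : Plane | u < ‖x‖} from
        fun h => hx ((show t < u from hu).trans h))]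

/-- The sum of `ψ a` over the points at distance more than `b`. -/
noncomputable def sumBeyond (ψ : ℝ → Plane → ℝ≥0∞) (b a : ℝ) (x : ℕ → Plane) : ℝ≥0∞ :=
  ∑' j, {x : Plane | b < ‖x‖}.indicator (ψ a) (x j)

lemma measurable_sumBeyond {ψ : ℝ → Plane → ℝ≥0∞}
    (hψ : Measurable (Function.uncurry ψ)) (b a : ℝ) :
    Measurable (sumBeyond ψ b a) :=
  Measurable.tsum fun j => (Measurable.indicator (hψ.comp measurable_prodMk_left)
    (measurableSet_lt_norm b)).comp (measurable_pi_apply j)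

/-- `exp (-lam π t²)`, the probability that no point lies in the disk of radius `t`. -/
noncomputable def voidProb (lam t : ℝ) : ℝ := Real.exp (-(lam * Real.pi * t ^ 2))

lemma volume_closedBall_plane {t : ℝ} (ht : 0 ≤ t) :
    volume (Metric.closedBall (0 : Plane) t) = ENNReal.ofReal (Real.pi * t ^ 2) := by
  rw [EuclideanSpace.volume_closedBall_fin_two, ← ENNReal.ofReal_pow ht, mul_comm,
    ENNReal.ofReal_mul Real.pi_pos.le, ENNReal.ofReal_eq_coe_nnreal Real.pi_pos.le]

lemma expNeg_volume_closedBall {lam t : ℝ} (hlam : 0 ≤ lam) (ht : 0 ≤ t) :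
    expNeg (ENNReal.ofReal lam * volume (Metric.closedBall (0 : Plane) t)) = voidProb lam t := by
  rw [volume_closedBall_plane ht, ← ENNReal.ofReal_mul hlam, expNeg_ofReal (by positivity),
    voidProb, mul_assoc]

namespace IsHomogeneousPPP

variable {Ω : Type*} [MeasurableSpace Ω] {P : Measure Ω} {lam : ℝ}
  {X : ℕ → Ω → Plane}

lemma measurable_swap (hX : IsHomogeneousPPP P lam X) : Measurable fun ω j => X j ω :=
  measurable_pi_lambda _ hX.measurable

/-- A ball containing `X 0` holds finitely many points almost surely, so the minimal norm is
attained and the `sInf` in `nearest` is a true minimiser. -/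
lemma ae_nearestDist_le (hX : IsHomogeneousPPP P lam X) :
    ∀ᵐ ω ∂P, ∀ j, nearestDist (fun i => X i ω) ≤ ‖X j ω‖ := by
  have h : ∀ᵐ ω ∂P, ∀ n : ℕ, pointCount X (Metric.ball (0 : Plane) n) ω < ∞ :=
    ae_all_iff.2 fun n => hX.ae_pointCount_lt_top measurableSet_ball measure_ball_lt_top.ne
  filter_upwards [h] with ω hω
  obtain ⟨n, hn⟩ := exists_nat_gt ‖X 0 ω‖
  have hfin := finite_of_pointCount_lt_top (hω n)
  have h0 : 0 ∈ {i | X i ω ∈ Metric.ball (0 : Plane) n} := mem_ball_zero_iff.2 hn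
  obtain ⟨i, hi, hmin⟩ := exists_min_image _ (fun i => ‖X i ω‖) hfin ⟨0, h0⟩
  have hne : {i | ∀ j, ‖X i ω‖ ≤ ‖X j ω‖}.Nonempty := by
    refine ⟨i, fun j => ?_⟩
    by_cases hj : X j ω ∈ Metric.ball (0 : Plane) n
    · exact hmin j hj
    · rw [mem_ball_zero_iff, not_lt] at hj
      exact (hmin 0 h0).trans (hn.le.trans hj)
  exact Nat.sInf_mem hne

lemma ae_nearestDist_pos (hX : IsHomogeneousPPP P lam X) :
    ∀ᵐ ω ∂P, 0 < nearestDist fun i => X i ω := by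
  filter_upwards [hX.ae_notMem (A := {0}) (by simp)] with ω hω
  exact norm_pos_iff.2 (hω _)

variable {ψ : ℝ → Plane → ℝ≥0∞}

/-- Giving weight `∞` to the closed disk of radius `t` makes `expNeg` vanish exactly when the disk
contains a point, so the void event becomes part of a Laplace functional. As `t ≤ b`, the disk and
the region beyond `b` are disjoint and their exponents add. -/
lemma setIntegral_expNeg_sumBeyond [IsProbabilityMeasure P] (hX : IsHomogeneousPPP P lam X)
    (hlam : 0 ≤ lam) (hψ : Measurable (Function.uncurry ψ)) {t b : ℝ} (ht : 0 ≤ t) (htb : t ≤ b)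
    (a : ℝ) :
    ∫ ω in {ω | t < nearestDist fun i => X i ω}, expNeg (sumBeyond ψ b a fun i => X i ω) ∂P
      = voidProb lam t * expNeg (ENNReal.ofReal lam * tailIntegral ψ b a) := by
  classical
  have hm : Measurable (ψ a) := hψ.comp measurable_prodMk_left
  let φ : Plane → ℝ≥0∞ := fun x =>
    if x ∈ Metric.closedBall 0 t then ∞ else {x : Plane | b < ‖x‖}.indicator (ψ a) x
  have hφ : Measurable φ := Measurable.ite measurableSet_closedBall measurable_const
    (hm.indicator (measurableSet_lt_norm b))
  have hr : MeasurableSet {ω | t < nearestDist fun i => X i ω} :=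
    measurableSet_lt measurable_const (measurable_nearestDist.comp hX.measurable_swap)
  rw [← integral_indicator hr, ← expNeg_volume_closedBall hlam ht, ← expNeg_add, ← mul_add]
  have h1 : volume (Metric.closedBall (0 : Plane) t) + tailIntegral ψ b a
      = ∫⁻ x, ENNReal.ofReal (1 - expNeg (φ x)) := by
    unfold tailIntegral
    rw [← lintegral_indicator_one measurableSet_closedBall,
      ← lintegral_indicator (measurableSet_lt_norm b),
      ← lintegral_add_left (measurable_one.indicator measurableSet_closedBall)]
    refine lintegral_congr fun x => ?_
    by_cases hx : x ∈ Metric.closedBall (0 : Plane) t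
    · have hx' : ‖x‖ ≤ t := mem_closedBall_zero_iff.1 hx
      have hxb : x ∉ {x : Plane | b < ‖x‖} := fun h => absurd h (not_lt.2 (hx'.trans htb))
      simp only [φ, if_pos hx, indicator_of_mem hx, indicator_of_notMem hxb, expNeg_top]
      simp
    · by_cases hxb : x ∈ {x : Plane | b < ‖x‖}
      · simp only [φ, if_neg hx, indicator_of_mem hxb, indicator_of_notMem hx, zero_add]
      · simp only [φ, if_neg hx, indicator_of_notMem hx, indicator_of_notMem hxb, expNeg_zero]
        simp
  rw [h1, ← hX.integral_expNeg_tsum hφ]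
  refine integral_congr_ae ?_
  filter_upwards [hX.ae_nearestDist_le] with ω hω
  by_cases hω' : t < nearestDist fun i => X i ω
  · rw [indicator_of_mem (show ω ∈ {ω | t < nearestDist fun i => X i ω} from hω')]
    unfold sumBeyond
    congr 2 with j
    have hj : X j ω ∉ Metric.closedBall (0 : Plane) t := fun h =>
      absurd (mem_closedBall_zero_iff.1 h) (not_le.2 (hω'.trans_le (hω j)))
    simp only [φ, if_neg hj]
  · rw [indicator_of_notMem (show ω ∉ {ω | t < nearestDist fun i => X i ω} from hω')]
    have hn : X (nearest fun i => X i ω) ω ∈ Metric.closedBall (0 : Plane) t :=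
      mem_closedBall_zero_iff.2 (not_lt.1 hω')
    have htop : ∑' i, φ (X i ω) = ∞ := by
      refine ENNReal.tsum_eq_top_of_eq_top ⟨nearest fun i => X i ω, ?_⟩
      simp only [φ, if_pos hn]
    rw [htop, expNeg_top]

/-- The event is the difference of the void events for `t` and `u`; the points beyond `u` contribute
the same factor to both. -/
lemma setIntegral_Ioc_expNeg_sumBeyond [IsProbabilityMeasure P] (hX : IsHomogeneousPPP P lam X)
    (hlam : 0 ≤ lam) (hψ : Measurable (Function.uncurry ψ)) {t u : ℝ} (ht : 0 ≤ t) (htu : t ≤ u)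
    (a : ℝ) :
    ∫ ω in {ω | (nearestDist fun i => X i ω) ∈ Ioc t u},
        expNeg (sumBeyond ψ u a fun i => X i ω) ∂P
      = (voidProb lam t - voidProb lam u) *
        expNeg (ENNReal.ofReal lam * tailIntegral ψ u a) := by
  have hd : Measurable fun ω => nearestDist fun i => X i ω :=
    measurable_nearestDist.comp hX.measurable_swap
  have hset : {ω | (nearestDist fun i => X i ω) ∈ Ioc t u}
      = {ω | t < nearestDist fun i => X i ω} \ {ω | u < nearestDist fun i => X i ω} := by
    ext ω; simp
  have hint : Integrable (fun ω => expNeg (sumBeyond ψ u a fun i => X i ω)) P :=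
    integrable_expNeg ((measurable_sumBeyond hψ u a).comp hX.measurable_swap).aemeasurable
  rw [hset, setIntegral_sdiff (measurableSet_lt measurable_const hd) hint.integrableOn
    (ofPred_subset_ofPred.2 fun ω h => lt_of_le_of_lt htu h),
    hX.setIntegral_expNeg_sumBeyond hlam hψ ht htu,
    hX.setIntegral_expNeg_sumBeyond hlam hψ (ht.trans htu) le_rfl, sub_mul]

/-- If `t < D ≤ u`, every point beyond `u` differs from the nearest one and has weight `ψ D ≥ ψ t`;
discarding the other points only increases `expNeg`. -/
lemma setIntegral_Ioc_le [IsProbabilityMeasure P] (hX : IsHomogeneousPPP P lam X)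
    (hlam : 0 ≤ lam) (hψ : Measurable (Function.uncurry ψ))
    (hmono : ∀ x a b, 0 ≤ a → a ≤ b → ψ a x ≤ ψ b x) {t u : ℝ} (ht : 0 ≤ t) (htu : t ≤ u) :
    ∫ ω in {ω | (nearestDist fun i => X i ω) ∈ Ioc t u},
        expNeg (sumBeyondNearest ψ fun i => X i ω) ∂P
      ≤ (voidProb lam t - voidProb lam u) *
        expNeg (ENNReal.ofReal lam * tailIntegral ψ u t) := by
  have hd : Measurable fun ω => nearestDist fun i => X i ω :=
    measurable_nearestDist.comp hX.measurable_swap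
  rw [← hX.setIntegral_Ioc_expNeg_sumBeyond hlam hψ ht htu]
  refine setIntegral_mono_on
    (integrable_expNeg
      ((measurable_sumBeyondNearest hψ).comp hX.measurable_swap).aemeasurable).integrableOn
    (integrable_expNeg
      ((measurable_sumBeyond hψ u t).comp hX.measurable_swap).aemeasurable).integrableOn
    (hd measurableSet_Ioc) fun ω hω => expNeg_antitone (ENNReal.tsum_le_tsum fun j => ?_)
  have hω' : t < nearestDist (fun i => X i ω) ∧ nearestDist (fun i => X i ω) ≤ u := hω
  by_cases hj : X j ω ∈ {x : Plane | u < ‖x‖}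
  · rw [indicator_of_mem hj, if_neg]
    · exact hmono _ _ _ ht hω'.1.le
    · rintro rfl
      exact absurd hω'.2 (not_le.2 hj)
  · rw [indicator_of_notMem hj]
    exact zero_le

/-- If the annulus holds only the nearest point, all others lie beyond `u` and have weight `ψ D ≤ ψ
u`. The exceptional event, with two points in the annulus, costs at most its probability because the
integrand is at most 1. -/
lemma le_setIntegral_Ioc [IsProbabilityMeasure P] (hX : IsHomogeneousPPP P lam X)
    (hlam : 0 ≤ lam) (hψ : Measurable (Function.uncurry ψ))
    (hmono : ∀ x a b, 0 ≤ a → a ≤ b → ψ a x ≤ ψ b x) {t u : ℝ} (ht : 0 ≤ t) (htu : t ≤ u) :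
    (voidProb lam t - voidProb lam u) * expNeg (ENNReal.ofReal lam * tailIntegral ψ u u)
        - (lam * Real.pi * (u ^ 2 - t ^ 2)) ^ 2
      ≤ ∫ ω in {ω | (nearestDist fun i => X i ω) ∈ Ioc t u},
        expNeg (sumBeyondNearest ψ fun i => X i ω) ∂P := by
  have hd : Measurable fun ω => nearestDist fun i => X i ω :=
    measurable_nearestDist.comp hX.measurable_swap
  set A : Set Plane := Metric.closedBall 0 u \ Metric.closedBall 0 t with hA
  have hAm : MeasurableSet A := measurableSet_closedBall.diff measurableSet_closedBall
  have hAv : volume A = ENNReal.ofReal (Real.pi * (u ^ 2 - t ^ 2)) := by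
    rw [hA, measure_sdiff (Metric.closedBall_subset_closedBall htu)
      measurableSet_closedBall.nullMeasurableSet measure_closedBall_lt_top.ne,
      volume_closedBall_plane ht, volume_closedBall_plane (ht.trans htu),
      ← ENNReal.ofReal_sub _ (by positivity), mul_sub]
  have hsq : 0 ≤ u ^ 2 - t ^ 2 := by nlinarith
  have hprob : P.real {ω | ¬ pointCount X A ω ≤ 1} ≤ (lam * Real.pi * (u ^ 2 - t ^ 2)) ^ 2 := by
    refine (hX.measureReal_two_le_pointCount_le hAm (by simp [hAv])).trans_eq ?_
    rw [hAv, ← ENNReal.ofReal_mul hlam, ENNReal.toReal_ofReal (by positivity), mul_assoc]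
  have hms : MeasurableSet {ω | ¬ pointCount X A ω ≤ 1} :=
    (measurableSet_le (hX.measurable_pointCount hAm) measurable_const).compl
  have hr : MeasurableSet {ω | (nearestDist fun i => X i ω) ∈ Ioc t u} := hd measurableSet_Ioc
  have hi1 : Integrable (fun ω => expNeg (sumBeyond ψ u u fun i => X i ω)) P :=
    integrable_expNeg ((measurable_sumBeyond hψ u u).comp hX.measurable_swap).aemeasurable
  have hi2 : Integrable (fun ω => expNeg (sumBeyondNearest ψ fun i => X i ω)) P :=
    integrable_expNeg ((measurable_sumBeyondNearest hψ).comp hX.measurable_swap).aemeasurable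
  have hi3 : Integrable ({ω | ¬ pointCount X A ω ≤ 1}.indicator fun _ => (1 : ℝ)) P :=
    (integrable_const 1).indicator hms
  rw [← hX.setIntegral_Ioc_expNeg_sumBeyond hlam hψ ht htu, sub_le_iff_le_add]
  refine le_trans ?_ (add_le_add_right hprob _)
  rw [← integral_indicator hr, ← integral_indicator hr,
    show P.real {ω | ¬ pointCount X A ω ≤ 1}
      = ∫ ω, {ω | ¬ pointCount X A ω ≤ 1}.indicator (fun _ => (1 : ℝ)) ω ∂P from
      (integral_indicator_one hms).symm,
    ← integral_add (hi2.indicator hr) hi3]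
  refine integral_mono_ae (hi1.indicator hr) ((hi2.indicator hr).add hi3) ?_
  filter_upwards [hX.ae_nearestDist_le] with ω hω
  by_cases hω' : ω ∈ {ω | (nearestDist fun i => X i ω) ∈ Ioc t u}
  · rw [indicator_of_mem hω', indicator_of_mem hω']
    by_cases hc : pointCount X A ω ≤ 1
    · rw [indicator_of_notMem (by simpa using hc), add_zero]
      refine expNeg_antitone (ENNReal.tsum_le_tsum fun j => ?_)
      split_ifs with hj
      · exact zero_le
      · have h1 : t < nearestDist (fun i => X i ω) ∧ nearestDist (fun i => X i ω) ≤ u := hω'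
        -- Otherwise `X j` and the nearest point both lie in the annulus, which forces `j` to be the
        -- nearest index.
        have hju : X j ω ∈ {x : Plane | u < ‖x‖} := by
          by_contra hju
          refine hj (eq_of_pointCount_le_one hc (i := j) ⟨?_, ?_⟩ ⟨?_, ?_⟩)
          · exact mem_closedBall_zero_iff.2 (not_lt.1 hju)
          · exact fun h => absurd (mem_closedBall_zero_iff.1 h)
              (not_le.2 (h1.1.trans_le (hω j)))
          · exact mem_closedBall_zero_iff.2 h1.2
          · exact fun h => absurd (mem_closedBall_zero_iff.1 h) (not_le.2 h1.1)
        rw [indicator_of_mem hju]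
        exact hmono _ _ _ (nearestDist_nonneg _) h1.2
    · rw [indicator_of_mem (show ω ∈ {ω | ¬ pointCount X A ω ≤ 1} from hc)]
      linarith [expNeg_le_one (sumBeyond ψ u u fun i => X i ω),
        expNeg_nonneg (sumBeyondNearest ψ fun i => X i ω)]
  · rw [indicator_of_notMem hω', indicator_of_notMem hω', zero_add]
    exact indicator_nonneg (fun _ _ => zero_le_one) _

end IsHomogeneousPPP

/-! ### Differentiation in the nearest distance and the joint law -/

/-- Density of the distance to the nearest point, weighted by the Laplace functional of `ψ` over
the points further away. -/
noncomputable def nearestDensity (lam : ℝ) (ψ : ℝ → Plane → ℝ≥0∞) (u : ℝ) : ℝ :=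
  2 * Real.pi * lam * u * voidProb lam u * expNeg (ENNReal.ofReal lam * tailIntegral ψ u u)

lemma measurable_nearestDensity (lam : ℝ) {ψ : ℝ → Plane → ℝ≥0∞}
    (hψ : Measurable (Function.uncurry ψ)) : Measurable (nearestDensity lam ψ) := by
  have := measurable_tailIntegral_diag hψ
  unfold nearestDensity voidProb
  fun_prop

lemma nearestDensity_nonneg {lam : ℝ} (hlam : 0 ≤ lam) (ψ : ℝ → Plane → ℝ≥0∞) {u : ℝ}
    (hu : 0 ≤ u) : 0 ≤ nearestDensity lam ψ u := by
  have := expNeg_nonneg (ENNReal.ofReal lam * tailIntegral ψ u u)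
  unfold nearestDensity voidProb
  positivity

lemma hasDerivAt_voidProb (lam t : ℝ) :
    HasDerivAt (voidProb lam) (-(2 * Real.pi * lam * t * voidProb lam t)) t := by
  unfold voidProb
  have h := (((hasDerivAt_pow 2 t).const_mul (lam * Real.pi)).neg).exp
  refine h.congr_deriv ?_
  simp only [Nat.cast_ofNat, Nat.add_one_sub_one, pow_one, Pi.neg_apply]
  ring

lemma continuous_voidProb (lam : ℝ) : Continuous (voidProb lam) := by
  unfold voidProb; fun_prop

lemma intervalIntegrable_nearestDensity (lam : ℝ) {ψ : ℝ → Plane → ℝ≥0∞}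
    (hψ : Measurable (Function.uncurry ψ)) (a b : ℝ) :
    IntervalIntegrable (nearestDensity lam ψ) volume a b := by
  have hc : Continuous fun u => 2 * Real.pi * lam * u * voidProb lam u := by
    have := continuous_voidProb lam
    fun_prop
  refine (hc.intervalIntegrable a b).mono_fun
    (measurable_nearestDensity lam hψ).aestronglyMeasurable (ae_of_all _ fun u => ?_)
  simp only [nearestDensity]
  rw [norm_mul]
  exact mul_le_of_le_one_right (norm_nonneg _) (norm_expNeg_le_one _)

namespace IsHomogeneousPPP

variable {Ω : Type*} [MeasurableSpace Ω] {P : Measure Ω} {lam : ℝ}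
  {X : ℕ → Ω → Plane} {ψ : ℝ → Plane → ℝ≥0∞}

lemma setIntegral_Iic_sub [IsProbabilityMeasure P] (hX : IsHomogeneousPPP P lam X)
    (hψ : Measurable (Function.uncurry ψ)) {t u : ℝ} (htu : t ≤ u) :
    ∫ ω in {ω | (nearestDist fun i => X i ω) ∈ Iic u},
        expNeg (sumBeyondNearest ψ fun i => X i ω) ∂P
      - ∫ ω in {ω | (nearestDist fun i => X i ω) ∈ Iic t},
        expNeg (sumBeyondNearest ψ fun i => X i ω) ∂P
      = ∫ ω in {ω | (nearestDist fun i => X i ω) ∈ Ioc t u},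
        expNeg (sumBeyondNearest ψ fun i => X i ω) ∂P := by
  have hd : Measurable fun ω => nearestDist fun i => X i ω :=
    measurable_nearestDist.comp hX.measurable_swap
  have hi : Integrable (fun ω => expNeg (sumBeyondNearest ψ fun i => X i ω)) P :=
    integrable_expNeg ((measurable_sumBeyondNearest hψ).comp hX.measurable_swap).aemeasurable
  have hset : {ω | (nearestDist fun i => X i ω) ∈ Ioc t u}
      = {ω | (nearestDist fun i => X i ω) ∈ Iic u} \
        {ω | (nearestDist fun i => X i ω) ∈ Iic t} := by
    ext ω; simp [and_comm]
  have hsub : {ω | (nearestDist fun i => X i ω) ∈ Iic t}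
      ⊆ {ω | (nearestDist fun i => X i ω) ∈ Iic u} :=
    ofPred_subset_ofPred.2 fun ω h => le_trans h htu
  have hm : MeasurableSet {ω | (nearestDist fun i => X i ω) ∈ Iic t} := hd measurableSet_Iic
  rw [hset, setIntegral_sdiff hm hi.integrableOn hsub]

/-- The left side is a continuous function of `t` vanishing at 0; the annulus estimates give its
right derivative at every interior point, which suffices for the fundamental theorem of calculus
since `nearestDensity` is interval integrable. -/
lemma setIntegral_Iic_eq_intervalIntegral [IsProbabilityMeasure P]
    (hX : IsHomogeneousPPP P lam X) (hlam : 0 ≤ lam) (hψ : Measurable (Function.uncurry ψ))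
    (hmono : ∀ x a b, 0 ≤ a → a ≤ b → ψ a x ≤ ψ b x)
    (hcont : ∀ x : Plane, x ≠ 0 → ∀ t, 0 < t → ContinuousAt (fun a => expNeg (ψ a x)) t)
    (hfin : ∀ t a, 0 < t → 0 < a → tailIntegral ψ t a ≠ ∞) {t : ℝ} (ht : 0 ≤ t) :
    ∫ ω in {ω | (nearestDist fun i => X i ω) ∈ Iic t},
        expNeg (sumBeyondNearest ψ fun i => X i ω) ∂P
      = ∫ u in (0 : ℝ)..t, nearestDensity lam ψ u := by
  set H : ℝ → ℝ := fun t => ∫ ω in {ω | (nearestDist fun i => X i ω) ∈ Iic t},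
    expNeg (sumBeyondNearest ψ fun i => X i ω) ∂P with hH
  have hsub : ∀ t u, t ≤ u → H u - H t = ∫ ω in {ω | (nearestDist fun i => X i ω) ∈ Ioc t u},
      expNeg (sumBeyondNearest ψ fun i => X i ω) ∂P := fun t u h =>
    hX.setIntegral_Iic_sub hψ h
  have hE : ∀ t u, 0 ≤ t → t ≤ u → 0 ≤ voidProb lam t - voidProb lam u := fun t u h h' => by
    unfold voidProb
    rw [sub_nonneg, Real.exp_le_exp, neg_le_neg_iff]
    gcongr
  have hup : ∀ t u, 0 ≤ t → t ≤ u → H u - H t ≤ voidProb lam t - voidProb lam u := by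
    intro t u h h'
    rw [hsub t u h']
    exact (hX.setIntegral_Ioc_le hlam hψ hmono h h').trans
      (mul_le_of_le_one_right (hE t u h h') (expNeg_le_one _))
  have hlow : ∀ t u, t ≤ u → 0 ≤ H u - H t := by
    intro t u h
    rw [hsub t u h]
    exact integral_nonneg fun _ => expNeg_nonneg _
  -- The increments of `H` lie between 0 and the decrements of the continuous function `voidProb`.
  have hcontH : ContinuousOn H (uIcc 0 t) := by
    rw [uIcc_of_le ht]
    intro a ha
    rw [ContinuousWithinAt, tendsto_iff_dist_tendsto_zero]
    have hv : Tendsto (fun u => dist (voidProb lam u) (voidProb lam a)) (𝓝[Icc 0 t] a) (𝓝 0) :=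
      tendsto_iff_dist_tendsto_zero.1
        ((continuous_voidProb lam).tendsto a |>.mono_left nhdsWithin_le_nhds)
    refine squeeze_zero' (Eventually.of_forall fun _ => dist_nonneg) ?_ hv
    filter_upwards [self_mem_nhdsWithin] with u hu
    rw [Real.dist_eq, Real.dist_eq]
    rcases le_total a u with h | h
    · rw [abs_of_nonneg (hlow a u h), abs_of_nonpos (by linarith [hE a u ha.1 h])]
      linarith [hup a u ha.1 h]
    · rw [abs_of_nonpos (by linarith [hlow u a h]), abs_of_nonneg (hE u a hu.1 h)]
      linarith [hup u a hu.1 h]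
  have hderiv : ∀ x ∈ Ioo (min 0 t) (max 0 t),
      HasDerivWithinAt H (nearestDensity lam ψ x) (Ioi x) x := by
    intro x hx
    rw [min_eq_left ht, max_eq_right ht] at hx
    have hx0 := hx.1
    rw [hasDerivWithinAt_iff_tendsto_slope' (by simp)]
    have hid : Tendsto (fun u : ℝ => u) (𝓝[>] x) (𝓝 x) := nhdsWithin_le_nhds
    have hs : Tendsto (slope (voidProb lam) x) (𝓝[>] x)
        (𝓝 (-(2 * Real.pi * lam * x * voidProb lam x))) :=
      (hasDerivWithinAt_iff_tendsto_slope' (by simp)).1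
        ((hasDerivAt_voidProb lam x).hasDerivWithinAt (s := Ioi x))
    have hV : ∀ a : ℝ → ℝ, Tendsto a (𝓝[>] x) (𝓝 x) → (∀ u, x < u → 0 ≤ a u) →
        (∀ u, x < u → a u ≤ u) →
        Tendsto (fun u => expNeg (ENNReal.ofReal lam * tailIntegral ψ u (a u))) (𝓝[>] x)
          (𝓝 (expNeg (ENNReal.ofReal lam * tailIntegral ψ x x))) := fun a h1 h2 h3 =>
      (continuous_expNeg.tendsto _).comp (ENNReal.Tendsto.const_mul
        (tendsto_tailIntegral hψ hmono hx0 (fun y hy => hcont y hy x hx0)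
          (hfin x (x + 1) hx0 (by linarith)) h1 h2 h3) (Or.inr ENNReal.ofReal_ne_top))
    have hG1 := hV (fun _ => x) tendsto_const_nhds (fun _ _ => hx0.le) (fun u hu => hu.le)
    have hG2 := hV (fun u => u) hid (fun u hu => (hx0.trans hu).le) (fun u _ => le_rfl)
    -- This is the two-point error `(λπ(u² - x²))²` divided by `u - x`.
    have hq : Tendsto (fun u : ℝ => (lam * Real.pi) ^ 2 * ((u - x) * (u + x) ^ 2)) (𝓝[>] x)
        (𝓝 0) := by
      have : Continuous fun u : ℝ => (lam * Real.pi) ^ 2 * ((u - x) * (u + x) ^ 2) := by fun_prop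
      have h := (this.tendsto x).mono_left (nhdsWithin_le_nhds (s := Ioi x))
      simpa using h
    have hD : nearestDensity lam ψ x = -(-(2 * Real.pi * lam * x * voidProb lam x)) *
        expNeg (ENNReal.ofReal lam * tailIntegral ψ x x) := by
      rw [neg_neg]; rfl
    rw [hD]
    have hlo := (hs.neg.mul hG2).sub hq
    rw [sub_zero] at hlo
    refine tendsto_of_tendsto_of_tendsto_of_le_of_le' hlo (hs.neg.mul hG1) ?_ ?_
    · filter_upwards [self_mem_nhdsWithin] with u hu
      have hu' : x < u := hu
      have h := hX.le_setIntegral_Ioc hlam hψ hmono hx0.le hu'.le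
      rw [← hsub x u hu'.le] at h
      rw [slope_def_field, slope_def_field, le_div_iff₀ (sub_pos.2 hu')]
      refine le_trans (le_of_eq ?_) h
      have : u - x ≠ 0 := (sub_pos.2 hu').ne'
      field_simp
      ring
    · filter_upwards [self_mem_nhdsWithin] with u hu
      have hu' : x < u := hu
      have h := hX.setIntegral_Ioc_le hlam hψ hmono hx0.le hu'.le
      rw [← hsub x u hu'.le] at h
      rw [slope_def_field, slope_def_field, div_le_iff₀ (sub_pos.2 hu')]
      refine h.trans (le_of_eq ?_)
      have : u - x ≠ 0 := (sub_pos.2 hu').ne'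
      field_simp
      ring
  have hH0 : H 0 = 0 := by
    refine setIntegral_measure_zero _ ?_
    refine measure_eq_zero_iff_ae_notMem.2 ?_
    filter_upwards [hX.ae_nearestDist_pos] with ω hω
    exact not_le.2 hω
  rw [intervalIntegral.integral_eq_sub_of_hasDeriv_right hcontH hderiv
    (intervalIntegrable_nearestDensity lam hψ 0 t), hH0, sub_zero]

/-- Finite measures on the line are determined by the half-lines `Iic t`; for `t < 0` both sides
vanish, for `t ≥ 0` this is the integrated formula. -/
lemma map_withDensity_nearestDist [IsProbabilityMeasure P]
    (hX : IsHomogeneousPPP P lam X) (hlam : 0 ≤ lam) (hψ : Measurable (Function.uncurry ψ))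
    (hmono : ∀ x a b, 0 ≤ a → a ≤ b → ψ a x ≤ ψ b x)
    (hcont : ∀ x : Plane, x ≠ 0 → ∀ t, 0 < t → ContinuousAt (fun a => expNeg (ψ a x)) t)
    (hfin : ∀ t a, 0 < t → 0 < a → tailIntegral ψ t a ≠ ∞) :
    (P.withDensity fun ω => ENNReal.ofReal
        (expNeg (sumBeyondNearest ψ fun i => X i ω))).map (fun ω => nearestDist fun i => X i ω)
      = (volume.restrict (Ioi 0)).withDensity
          fun u => ENNReal.ofReal (nearestDensity lam ψ u) := by
  have hd : Measurable fun ω => nearestDist fun i => X i ω :=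
    measurable_nearestDist.comp hX.measurable_swap
  have hi : Integrable (fun ω => expNeg (sumBeyondNearest ψ fun i => X i ω)) P :=
    integrable_expNeg ((measurable_sumBeyondNearest hψ).comp hX.measurable_swap).aemeasurable
  have : IsFiniteMeasure (P.withDensity fun ω => ENNReal.ofReal
      (expNeg (sumBeyondNearest ψ fun i => X i ω))) :=
    isFiniteMeasure_withDensity_ofReal hi.2
  refine Measure.ext_of_Iic _ _ fun t => ?_
  rw [Measure.map_apply hd measurableSet_Iic, withDensity_apply _ (hd measurableSet_Iic),
    ← ofReal_integral_eq_lintegral_ofReal hi.integrableOn (ae_of_all _ fun _ => expNeg_nonneg _),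
    withDensity_apply _ measurableSet_Iic, Measure.restrict_restrict measurableSet_Iic,
    inter_comm, Ioi_inter_Iic]
  rcases le_or_gt 0 t with ht | ht
  · have h := hX.setIntegral_Iic_eq_intervalIntegral hlam hψ hmono hcont hfin ht
    rw [show (fun ω => nearestDist fun i => X i ω) ⁻¹' Iic t
      = {ω | (nearestDist fun i => X i ω) ∈ Iic t} from rfl, h,
      intervalIntegral.integral_of_le ht]
    refine ofReal_integral_eq_lintegral_ofReal
      ((intervalIntegrable_iff_integrableOn_Ioc_of_le ht).1
        (intervalIntegrable_nearestDensity lam hψ 0 t)) ?_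
    filter_upwards [ae_restrict_mem measurableSet_Ioc] with u hu
    exact nearestDensity_nonneg hlam ψ hu.1.le
  · have he : (fun ω => nearestDist fun i => X i ω) ⁻¹' Iic t = ∅ := by
      ext ω
      simpa using ht.trans_le (nearestDist_nonneg _)
    rw [he, Ioc_eq_empty (not_lt.2 ht.le)]
    simp

/-- The joint law of the distance to the nearest point and of a Laplace functional of the points
further away. -/
lemma integral_nearestDist_mul_expNeg [IsProbabilityMeasure P]
    (hX : IsHomogeneousPPP P lam X) (hlam : 0 ≤ lam) (hψ : Measurable (Function.uncurry ψ))
    (hmono : ∀ x a b, 0 ≤ a → a ≤ b → ψ a x ≤ ψ b x)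
    (hcont : ∀ x : Plane, x ≠ 0 → ∀ t, 0 < t → ContinuousAt (fun a => expNeg (ψ a x)) t)
    (hfin : ∀ t a, 0 < t → 0 < a → tailIntegral ψ t a ≠ ∞) {g : ℝ → ℝ} (hg : Measurable g) :
    ∫ ω, expNeg (sumBeyondNearest ψ fun i => X i ω) * g (nearestDist fun i => X i ω) ∂P
      = ∫ u in Ioi 0, nearestDensity lam ψ u * g u := by
  have hd : Measurable fun ω => nearestDist fun i => X i ω :=
    measurable_nearestDist.comp hX.measurable_swap
  have hS : Measurable fun ω => expNeg (sumBeyondNearest ψ fun i => X i ω) :=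
    measurable_expNeg.comp ((measurable_sumBeyondNearest hψ).comp hX.measurable_swap)
  have h := congrArg (fun μ => ∫ u, g u ∂μ)
    (hX.map_withDensity_nearestDist hlam hψ hmono hcont hfin)
  rw [integral_map hd.aemeasurable hg.aestronglyMeasurable,
    integral_withDensity_eq_integral_toReal_smul hS.ennreal_ofReal (by simp),
    integral_withDensity_eq_integral_toReal_smul
      (measurable_nearestDensity lam hψ).ennreal_ofReal (by simp)] at h
  simp only [smul_eq_mul, ENNReal.toReal_ofReal (expNeg_nonneg _)] at h
  rw [h]
  refine setIntegral_congr_fun measurableSet_Ioi fun u hu => ?_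
  rw [ENNReal.toReal_ofReal (nearestDensity_nonneg hlam ψ (le_of_lt hu))]

end IsHomogeneousPPP

/-! ### The exponential distribution -/

section Exponential

lemma lintegral_expMeasure (mu : ℝ) {f : ℝ → ℝ≥0∞} (hf : Measurable f) :
    ∫⁻ x, f x ∂(expMeasure mu)
      = ∫⁻ x in Ioi 0, ENNReal.ofReal (mu * Real.exp (-(mu * x))) * f x := by
  have h : expMeasure mu = volume.withDensity (exponentialPDF mu) := rfl
  have hm : Measurable (exponentialPDF mu) :=
    (measurable_exponentialPDFReal mu).ennreal_ofReal
  rw [h, lintegral_withDensity_eq_lintegral_mul _ hm hf,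
    ← setLIntegral_congr (f := fun x => ENNReal.ofReal (mu * Real.exp (-(mu * x))) * f x)
      Ioi_ae_eq_Ici.symm, ← lintegral_indicator measurableSet_Ici]
  refine lintegral_congr fun x => ?_
  rw [Pi.mul_apply, exponentialPDF_eq]
  by_cases hx : 0 ≤ x
  · rw [indicator_of_mem (show x ∈ Ici (0 : ℝ) from hx), if_pos hx]
  · rw [indicator_of_notMem (show x ∉ Ici (0 : ℝ) from hx), if_neg hx]
    simp

lemma ae_pos_expMeasure (mu : ℝ) : ∀ᵐ x ∂(expMeasure mu), 0 < x := by
  have h := lintegral_expMeasure mu (f := (Iic 0).indicator 1)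
    (measurable_one.indicator measurableSet_Iic)
  rw [lintegral_indicator_one measurableSet_Iic,
    setLIntegral_congr_fun (g := fun _ => 0) measurableSet_Ioi fun x (hx : 0 < x) => by
      simp only
      rw [indicator_of_notMem (show x ∉ Iic (0 : ℝ) from not_le.2 hx), mul_zero],
    lintegral_zero] at h
  filter_upwards [measure_eq_zero_iff_ae_notMem.1 h] with x hx
  exact not_le.1 hx

/-- The Laplace transform `c ↦ mu / (mu + c)` of the exponential distribution. -/
noncomputable def expLaplace (mu : ℝ) (c : ℝ≥0∞) : ℝ := if c = ∞ then 0 else mu / (mu + c.toReal)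

lemma expLaplace_nonneg {mu : ℝ} (hmu : 0 < mu) (c : ℝ≥0∞) : 0 ≤ expLaplace mu c := by
  unfold expLaplace; split_ifs <;> positivity

lemma expLaplace_le_one {mu : ℝ} (hmu : 0 < mu) (c : ℝ≥0∞) : expLaplace mu c ≤ 1 := by
  unfold expLaplace
  split_ifs
  · exact zero_le_one
  · exact div_le_one_of_le₀ (by linarith [c.toReal_nonneg]) (by positivity)

@[fun_prop] lemma measurable_expLaplace (mu : ℝ) : Measurable (expLaplace mu) :=
  Measurable.ite (measurableSet_singleton ∞) measurable_const (by fun_prop)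

lemma lintegral_exp_mul_exp {mu c : ℝ} (hmu : 0 < mu) (hc : 0 ≤ c) :
    ∫⁻ x in Ioi (0 : ℝ), ENNReal.ofReal (mu * Real.exp (-(mu * x))) *
      ENNReal.ofReal (Real.exp (-(c * x))) = ENNReal.ofReal (mu / (mu + c)) := by
  have h : ∀ x : ℝ, ENNReal.ofReal (mu * Real.exp (-(mu * x))) *
      ENNReal.ofReal (Real.exp (-(c * x)))
      = ENNReal.ofReal (mu * Real.exp (-(mu + c) * x)) := fun x => by
    rw [← ENNReal.ofReal_mul (by positivity), mul_assoc, ← Real.exp_add]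
    ring_nf
  simp_rw [h]
  have hi : IntegrableOn (fun x => mu * Real.exp (-(mu + c) * x)) (Ioi 0) :=
    (exp_neg_integrableOn_Ioi 0 (by positivity)).const_mul mu
  rw [← ofReal_integral_eq_lintegral_ofReal hi (ae_of_all _ fun x => by positivity),
    integral_const_mul, integral_exp_mul_Ioi (by linarith)]
  rw [mul_zero, Real.exp_zero, neg_div_neg_eq, mul_one_div]

lemma integral_expNeg_mul_expMeasure {mu : ℝ} (hmu : 0 < mu) (c : ℝ≥0∞) :
    ∫ x, expNeg (c * ENNReal.ofReal x) ∂(expMeasure mu) = expLaplace mu c := by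
  by_cases hc : c = ∞
  · rw [integral_congr_ae (g := fun _ => 0)]
    · simp [expLaplace, hc]
    · filter_upwards [ae_pos_expMeasure mu] with x hx
      rw [hc, ENNReal.top_mul (by simpa using hx), expNeg_top]
  · rw [integral_eq_lintegral_of_nonneg_ae (ae_of_all _ fun _ => expNeg_nonneg _)
      (Measurable.aestronglyMeasurable (by fun_prop)),
      lintegral_expMeasure mu (by fun_prop), expLaplace, if_neg hc,
      setLIntegral_congr_fun (g := fun x => ENNReal.ofReal (mu * Real.exp (-(mu * x))) *
        ENNReal.ofReal (Real.exp (-(c.toReal * x)))) measurableSet_Ioi fun x hx => ?_,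
      lintegral_exp_mul_exp hmu ENNReal.toReal_nonneg,
      ENNReal.toReal_ofReal (div_nonneg hmu.le (by linarith [c.toReal_nonneg]))]
    have hx' : (0 : ℝ) < x := hx
    simp only
    rw [mul_comm c, expNeg_ofReal_mul hx'.le hc, mul_comm x]

lemma lintegral_ofReal_expMeasure_ne_top {mu : ℝ} (hmu : 0 < mu) :
    ∫⁻ x, ENNReal.ofReal x ∂(expMeasure mu) ≠ ∞ := by
  rw [lintegral_expMeasure mu (by fun_prop)]
  -- Half of the decay absorbs the factor `x`: since `(μ/2)x ≤ e^{μx/2}`, the integrand `μ x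
  -- e^{-μx}` is at most `2 e^{-μx/2}`.
  have hi : IntegrableOn (fun x => 2 * Real.exp (-(mu / 2) * x)) (Ioi 0) :=
    (exp_neg_integrableOn_Ioi 0 (by positivity)).const_mul 2
  refine ((setLIntegral_mono (g := fun x => ENNReal.ofReal (2 * Real.exp (-(mu / 2) * x)))
    (by fun_prop) fun x hx => ?_).trans_lt hi.setLIntegral_lt_top).ne
  have hx' : (0 : ℝ) < x := hx
  rw [← ENNReal.ofReal_mul (by positivity)]
  refine ENNReal.ofReal_le_ofReal ?_
  have h1 := Real.add_one_le_exp (mu / 2 * x)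
  have h2 : Real.exp (-(mu * x)) = Real.exp (-(mu / 2) * x) * Real.exp (-(mu / 2) * x) := by
    rw [← Real.exp_add]; ring_nf
  have h3 : Real.exp (mu / 2 * x) * Real.exp (-(mu / 2) * x) = 1 := by
    rw [← Real.exp_add]; simp
  have h4 := Real.exp_pos (-(mu / 2) * x)
  rw [h2]
  calc mu * (Real.exp (-(mu / 2) * x) * Real.exp (-(mu / 2) * x)) * x
      = 2 * Real.exp (-(mu / 2) * x) * ((mu / 2 * x) * Real.exp (-(mu / 2) * x)) := by ring
    _ ≤ 2 * Real.exp (-(mu / 2) * x) * (Real.exp (mu / 2 * x) * Real.exp (-(mu / 2) * x)) := by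
      gcongr; linarith
    _ = _ := by rw [h3, mul_one]

end Exponential

/-! ### Averaging over independent marks -/

section Independence

variable {Ω : Type*} [MeasurableSpace Ω] {P : Measure Ω}

/-- Fubini for the product law of `(A, B)`: one variable may be frozen while the other is averaged.
-/
lemma integral_comp_of_indepFun [IsProbabilityMeasure P] {α β : Type*} [MeasurableSpace α]
    [MeasurableSpace β] {A : Ω → α} {B : Ω → β} (hA : Measurable A) (hB : Measurable B)
    (h : IndepFun A B P) {Φ : α → β → ℝ} (hΦ : Measurable (Function.uncurry Φ)) {C : ℝ}
    (hC : ∀ a b, ‖Φ a b‖ ≤ C) :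
    ∫ ω, Φ (A ω) (B ω) ∂P = ∫ ω, ∫ ω', Φ (A ω) (B ω') ∂P ∂P := by
  have h1 : ∫ ω, Φ (A ω) (B ω) ∂P
      = ∫ z, Function.uncurry Φ z ∂(P.map fun ω => (A ω, B ω)) :=
    (integral_map (hA.prodMk hB).aemeasurable hΦ.aestronglyMeasurable).symm
  have : IsProbabilityMeasure (P.map A) := Measure.isProbabilityMeasure_map hA.aemeasurable
  have : IsProbabilityMeasure (P.map B) := Measure.isProbabilityMeasure_map hB.aemeasurable
  rw [h1, h.map_prod_eq_prod_map_map hA.aemeasurable hB.aemeasurable, integral_prod _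
    (Integrable.of_bound hΦ.aestronglyMeasurable C (ae_of_all _ fun z => hC z.1 z.2)),
    integral_map hA.aemeasurable hΦ.stronglyMeasurable.integral_prod_right'.aestronglyMeasurable]
  refine integral_congr_ae (ae_of_all _ fun ω => ?_)
  exact integral_map hB.aemeasurable (hΦ.comp measurable_prodMk_left).aestronglyMeasurable

lemma integral_comp_eq_sum [IsProbabilityMeasure P] {ι : Type*} [Fintype ι]
    [MeasurableSpace ι] [MeasurableSingletonClass ι] {κ : Ω → ι} (hκ : Measurable κ)
    {q : ι → ℝ} (hq : ∀ k, 0 ≤ q k) (hlaw : ∀ k, P {ω | κ ω = k} = ENNReal.ofReal (q k))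
    (f : ι → ℝ) : ∫ ω, f (κ ω) ∂P = ∑ k, q k * f k := by
  have : IsProbabilityMeasure (P.map κ) := Measure.isProbabilityMeasure_map hκ.aemeasurable
  rw [← integral_map hκ.aemeasurable (measurable_of_finite f).aestronglyMeasurable,
    integral_fintype (.of_finite)]
  refine Finset.sum_congr rfl fun k _ => ?_
  rw [map_measureReal_apply hκ (measurableSet_singleton k), smul_eq_mul, measureReal_def,
    show κ ⁻¹' {k} = {ω | κ ω = k} from rfl, hlaw, ENNReal.toReal_ofReal (hq k)]

variable {α ι : Type*} [MeasurableSpace α] [Fintype ι] [MeasurableSpace ι]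
  [MeasurableSingletonClass ι]

/-- Integration over independent exponential fadings and independent cases, conditionally on an
independent random element `A`. -/
lemma integral_mul_expNeg_marks [IsProbabilityMeasure P] {mu : ℝ} (hmu : 0 < mu)
    {A : Ω → α} {κ : ℕ → Ω → ι} {g : ℕ → Ω → ℝ} (hA : Measurable A)
    (hκ : ∀ j, Measurable (κ j)) (hg : ∀ j, Measurable (g j))
    (hiκ : iIndepFun κ P) (hig : iIndepFun g P)
    (hlaw : ∀ j, HasLaw (g j) (expMeasure mu) P) {q : ι → ℝ} (hq : ∀ k, 0 ≤ q k)
    (hlawκ : ∀ j k, P {ω | κ j ω = k} = ENNReal.ofReal (q k))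
    (h1 : IndepFun (fun ω => (A ω, fun j => κ j ω)) (fun ω j => g j ω) P)
    (h2 : IndepFun A (fun ω j => κ j ω) P)
    {u : α → ℝ} (hu : Measurable u) {C : ℝ} (hC : ∀ a, ‖u a‖ ≤ C)
    {v : ℕ → α → ι → ℝ≥0∞} (hv : ∀ j, Measurable (Function.uncurry (v j))) :
    ∫ ω, u (A ω) * expNeg (∑' j, v j (A ω) (κ j ω) * ENNReal.ofReal (g j ω)) ∂P
      = ∫ ω, u (A ω) *
          expNeg (∑' j, negLog (∑ k, q k * expLaplace mu (v j (A ω) k))) ∂P := by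
  have hκm : Measurable fun ω j => κ j ω := measurable_pi_lambda _ hκ
  have hgm : Measurable fun ω j => g j ω := measurable_pi_lambda _ hg
  have hbound : ∀ a x, ‖u a * expNeg x‖ ≤ C := fun a x => by
    rw [norm_mul]
    exact (mul_le_of_le_one_right (norm_nonneg _) (norm_expNeg_le_one _)).trans (hC a)
  -- The fadings are averaged first, with `A` and the cases frozen. The result is again `expNeg` of
  -- a series whose `j`-th term depends only on `A` and `κ j`, so the cases can be averaged in the
  -- same way.
  have hstep1 := integral_comp_of_indepFun (P := P) (hA.prodMk hκm) hgm h1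
    (Φ := fun z y => u z.1 * expNeg (∑' j, v j z.1 (z.2 j) * ENNReal.ofReal (y j)))
    (C := C) (by
      refine (hu.comp (by fun_prop)).mul (measurable_expNeg.comp (Measurable.tsum fun j => ?_))
      refine Measurable.mul ((hv j).comp (g := Function.uncurry (v j))
        (f := fun z : (α × (ℕ → ι)) × (ℕ → ℝ) => (z.1.1, z.1.2 j)) (by fun_prop)) (by fun_prop))
    (fun a b => hbound _ _)
  have hinner1 : ∀ z : α × (ℕ → ι),
      ∫ ω, u z.1 * expNeg (∑' j, v j z.1 (z.2 j) * ENNReal.ofReal (g j ω)) ∂P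
        = u z.1 * expNeg (∑' j, negLog (expLaplace mu (v j z.1 (z.2 j)))) := by
    intro z
    rw [integral_const_mul, integral_expNeg_tsum_of_iIndepFun hg hig
      (φ := fun j y => v j z.1 (z.2 j) * ENNReal.ofReal y) (fun j => by fun_prop)]
    congr 4 with j
    rw [← integral_expNeg_mul_expMeasure hmu]
    congr 1
    exact (hlaw j).integral_comp (f := fun y => expNeg (v j z.1 (z.2 j) * ENNReal.ofReal y))
      (Measurable.aestronglyMeasurable (by fun_prop))
  have hstep2 := integral_comp_of_indepFun (P := P) hA hκm h2
    (Φ := fun a y => u a * expNeg (∑' j, negLog (expLaplace mu (v j a (y j)))))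
    (C := C) (by
      refine (hu.comp (by fun_prop)).mul (measurable_expNeg.comp (Measurable.tsum fun j => ?_))
      refine measurable_negLog.comp ((measurable_expLaplace mu).comp ((hv j).comp
        (g := Function.uncurry (v j)) (f := fun z : α × (ℕ → ι) => (z.1, z.2 j)) (by fun_prop))))
    (fun a b => hbound _ _)
  refine hstep1.trans (((integral_congr_ae (ae_of_all _ fun ω => hinner1 _)).trans hstep2).trans ?_)
  refine integral_congr_ae (ae_of_all _ fun ω => ?_)
  beta_reduce
  rw [integral_const_mul, integral_expNeg_tsum_of_iIndepFun hκ hiκ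
    (φ := fun j k => negLog (expLaplace mu (v j (A ω) k))) (fun j => measurable_of_finite _)]
  congr 4 with j
  simp_rw [expNeg_negLog (expLaplace_nonneg hmu _) (expLaplace_le_one hmu _)]
  rw [integral_comp_eq_sum (hκ j) hq (hlawκ j) fun k => expLaplace mu (v j (A ω) k)]

end Independence

/-! ### Polar coordinates and finiteness of shot noise -/

section Radial

/-- In polar coordinates the integrand is `y^{1-α}`, integrable at infinity because `α > 2`. -/
lemma lintegral_norm_rpow_ne_top {α b : ℝ} (hα : 2 < α) (hb : 0 < b) :
    ∫⁻ x in {x : Plane | b < ‖x‖}, ENNReal.ofReal (‖x‖ ^ (-α)) ≠ ∞ := by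
  have h : Integrable (fun x : Plane => (Ioi b).indicator (fun y => y ^ (-α)) ‖x‖) := by
    rw [integrable_fun_norm_addHaar (volume : Measure Plane)
      (f := (Ioi b).indicator fun y => y ^ (-α))]
    have h1 : IntegrableOn (fun y : ℝ => y ^ (1 - α)) (Ioi b) :=
      integrableOn_Ioi_rpow_of_lt (by linarith) hb
    have h2 : Integrable ((Ioi b).indicator fun y : ℝ => y ^ (1 - α)) :=
      h1.integrable_indicator measurableSet_Ioi
    refine (h2.integrableOn (s := Ioi 0)).congr_fun (fun y hy => ?_) measurableSet_Ioi
    have hy' : (0 : ℝ) < y := hy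
    by_cases hyb : y ∈ Ioi b
    · simp only [indicator_of_mem hyb, finrank_euclideanSpace_fin, smul_eq_mul]
      rw [sub_eq_add_neg, Real.rpow_add hy', Real.rpow_one]
      simp
    · simp only [indicator_of_notMem hyb, smul_zero]
  rw [← lintegral_indicator (measurableSet_lt_norm b)]
  refine (lintegral_congr fun x => ?_).trans_ne h.lintegral_lt_top.ne
  by_cases hx : b < ‖x‖
  · rw [indicator_of_mem (show x ∈ {x : Plane | b < ‖x‖} from hx),
      indicator_of_mem (show ‖x‖ ∈ Ioi b from hx)]
  · rw [indicator_of_notMem (show x ∉ {x : Plane | b < ‖x‖} from hx),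
      indicator_of_notMem (show ‖x‖ ∉ Ioi b from hx), ENNReal.ofReal_zero]

lemma integral_norm_plane (f : ℝ → ℝ) :
    ∫ x : Plane, f ‖x‖ = 2 * Real.pi * ∫ y in Ioi (0 : ℝ), f y * y := by
  rw [integral_fun_norm_addHaar (volume : Measure Plane) f]
  have hv : (volume : Measure Plane).real (Metric.ball 0 1) = Real.pi := by
    rw [measureReal_def, EuclideanSpace.volume_ball_fin_two]
    simp [Real.pi_pos.le]
  rw [hv]
  simp only [finrank_euclideanSpace_fin, nsmul_eq_mul, smul_eq_mul, Nat.add_one_sub_one, pow_one]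
  rw [← mul_assoc]
  congr 2 with y
  ring

end Radial

lemma enorm_rpow_neg_of_ne_zero {x : Plane} (hx : x ≠ 0) (α : ℝ) :
    ‖x‖ₑ ^ (-α) = ENNReal.ofReal (‖x‖ ^ (-α)) := by
  rw [← ofReal_norm, ENNReal.ofReal_rpow_of_pos (norm_pos_iff.2 hx)]

/-- The power-law shot noise of a Poisson point process with exponential fading is finite. -/
lemma IsHomogeneousPPP.ae_tsum_fading_lt_top {Ω : Type*} [MeasurableSpace Ω] {P : Measure Ω}
    {lam : ℝ} {X : ℕ → Ω → Plane}
    (hX : IsHomogeneousPPP P lam X) {mu α : ℝ} (hmu : 0 < mu) (hα : 2 < α) {g : ℕ → Ω → ℝ}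
    (hg : ∀ j, Measurable (g j)) (hlaw : ∀ j, HasLaw (g j) (expMeasure mu) P)
    (hind : ∀ j, IndepFun (X j) (g j) P) :
    ∀ᵐ ω ∂P, ∑' j, ENNReal.ofReal (g j ω) * ‖X j ω‖ₑ ^ (-α) < ∞ := by
  -- Outside the unit disk the sum has finite mean by Campbell's formula. The disk holds almost
  -- surely finitely many points, none at the origin, so its terms have a finite sum although their
  -- mean may be infinite.
  let φ : Plane → ℝ≥0∞ := {x : Plane | 1 < ‖x‖}.indicator fun x => ENNReal.ofReal (‖x‖ ^ (-α))
  have hφ : Measurable φ := Measurable.indicator (by fun_prop) (measurableSet_lt_norm 1)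
  have hfar : ∀ᵐ ω ∂P, ∑' j, ENNReal.ofReal (g j ω) * φ (X j ω) < ∞ := by
    have hm : ∀ j, Measurable fun ω => ENNReal.ofReal (g j ω) * φ (X j ω) := fun j =>
      (hg j).ennreal_ofReal.mul (hφ.comp (hX.measurable j))
    refine ae_lt_top (Measurable.tsum hm) ?_
    rw [lintegral_tsum fun j => (hm j).aemeasurable]
    have hprod : ∀ j, ∫⁻ ω, ENNReal.ofReal (g j ω) * φ (X j ω) ∂P
        = (∫⁻ x, ENNReal.ofReal x ∂(expMeasure mu)) * ∫⁻ ω, φ (X j ω) ∂P := fun j => by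
      have hi := lintegral_mul_eq_lintegral_mul_lintegral_of_indepFun''
        (hg j).ennreal_ofReal.aemeasurable (hφ.comp (hX.measurable j)).aemeasurable
        ((hind j).symm.comp ENNReal.measurable_ofReal hφ)
      simp only [Function.comp_apply] at hi
      rw [hi, (hlaw j).lintegral_comp (f := fun x => ENNReal.ofReal x) (by fun_prop)]
    simp_rw [hprod]
    rw [ENNReal.tsum_mul_left, hX.lintegral_tsum_eq hφ]
    refine ENNReal.mul_ne_top (lintegral_ofReal_expMeasure_ne_top hmu)
      (ENNReal.mul_ne_top ENNReal.ofReal_ne_top ?_)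
    rw [lintegral_indicator (measurableSet_lt_norm 1)]
    exact lintegral_norm_rpow_ne_top hα one_pos
  filter_upwards [hfar, hX.ae_notMem (A := {0}) (by simp), hX.ae_pointCount_lt_top
    (A := Metric.closedBall 0 1) measurableSet_closedBall measure_closedBall_lt_top.ne]
    with ω h1 h2 h3
  have hfin := finite_of_pointCount_lt_top h3
  have hsplit : ∀ j, ENNReal.ofReal (g j ω) * ‖X j ω‖ₑ ^ (-α)
      = ENNReal.ofReal (g j ω) * φ (X j ω) +
        {j | X j ω ∈ Metric.closedBall (0 : Plane) 1}.indicator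
          (fun j => ENNReal.ofReal (g j ω) * ENNReal.ofReal (‖X j ω‖ ^ (-α))) j := by
    intro j
    rw [enorm_rpow_neg_of_ne_zero (h2 j)]
    by_cases hj : X j ω ∈ Metric.closedBall (0 : Plane) 1
    · have hj' : X j ω ∉ {x : Plane | 1 < ‖x‖} := not_lt.2 (mem_closedBall_zero_iff.1 hj)
      simp only [φ]
      rw [indicator_of_mem (show j ∈ {j | X j ω ∈ Metric.closedBall (0 : Plane) 1} from hj),
        indicator_of_notMem hj', mul_zero, zero_add]
    · have hj' : X j ω ∈ {x : Plane | 1 < ‖x‖} :=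
        not_le.1 fun h => hj (mem_closedBall_zero_iff.2 h)
      simp only [φ]
      rw [indicator_of_notMem (show j ∉ {j | X j ω ∈ Metric.closedBall (0 : Plane) 1} from hj),
        indicator_of_mem hj', add_zero]
  simp_rw [hsplit]
  rw [ENNReal.tsum_add, ENNReal.add_lt_top]
  refine ⟨h1, ?_⟩
  rw [tsum_eq_sum (s := hfin.toFinset) fun j hj => indicator_of_notMem (by simpa using hj) _]
  refine ENNReal.sum_lt_top.2 fun j _ => ?_
  refine (indicator_le_self _ _ j).trans_lt ?_
  exact ENNReal.mul_lt_top ENNReal.ofReal_lt_top ENNReal.ofReal_lt_top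

/-! ### A single interferer averaged over fading and case -/

lemma expLaplace_antitone {mu : ℝ} (hmu : 0 < mu) : Antitone (expLaplace mu) := by
  intro c d hcd
  have := isProbabilityMeasure_expMeasure hmu
  rw [← integral_expNeg_mul_expMeasure hmu, ← integral_expNeg_mul_expMeasure hmu]
  exact integral_mono (integrable_expNeg (by fun_prop)) (integrable_expNeg (by fun_prop))
    fun x => expNeg_antitone (mul_le_mul_left hcd _)

section ThinLaplace

variable {ι : Type*} [Fintype ι] {mu α : ℝ} {q d : ι → ℝ}

/-- Laplace transform of the power received from a transmitter at `x` with exponential fading,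
which falls into case `k` with probability `q k`; the gain is normalised by the mean fading. -/
noncomputable def thinLaplace (mu α : ℝ) (q d : ι → ℝ) (x : Plane) : ℝ :=
  ∑ k, q k * expLaplace mu (ENNReal.ofReal (mu * d k) * ‖x‖ₑ ^ (-α))

lemma thinLaplace_nonneg (hmu : 0 < mu) (hq : ∀ k, 0 ≤ q k) (x : Plane) :
    0 ≤ thinLaplace mu α q d x :=
  Finset.sum_nonneg fun k _ => mul_nonneg (hq k) (expLaplace_nonneg hmu _)

lemma thinLaplace_le_one (hmu : 0 < mu) (hq : ∀ k, 0 ≤ q k) (hq1 : ∑ k, q k = 1) (x : Plane) :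
    thinLaplace mu α q d x ≤ 1 := by
  rw [← hq1]
  exact Finset.sum_le_sum fun k _ => mul_le_of_le_one_right (hq k) (expLaplace_le_one hmu _)

lemma thinLaplace_anti (hmu : 0 < mu) (hq : ∀ k, 0 ≤ q k) {d' : ι → ℝ} (h : ∀ k, d k ≤ d' k)
    (x : Plane) : thinLaplace mu α q d' x ≤ thinLaplace mu α q d x :=
  Finset.sum_le_sum fun k _ => mul_le_mul_of_nonneg_left (expLaplace_antitone hmu
    (mul_le_mul_left (ENNReal.ofReal_le_ofReal (mul_le_mul_of_nonneg_left (h k) hmu.le)) _)) (hq k)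

/-- The gain is normalised by `mu`, which cancels: `mu / (mu + mu d ‖x‖^{-α}) = 1 - d / (d +
‖x‖^α)`. The leading ones add up to `∑ q k = 1`. -/
lemma thinLaplace_eq (hmu : 0 < mu) (hq1 : ∑ k, q k = 1) (hd : ∀ k, 0 ≤ d k) {x : Plane}
    (hx : x ≠ 0) :
    thinLaplace mu α q d x = 1 - ∑ k, q k * (d k / (d k + ‖x‖ ^ α)) := by
  rw [← hq1, ← Finset.sum_sub_distrib]
  refine Finset.sum_congr rfl fun k _ => ?_
  have hx' : 0 < ‖x‖ := norm_pos_iff.2 hx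
  have hp : 0 < ‖x‖ ^ α := Real.rpow_pos_of_pos hx' α
  rw [enorm_rpow_neg_of_ne_zero hx, ← ENNReal.ofReal_mul (mul_nonneg hmu.le (hd k)), expLaplace,
    if_neg ENNReal.ofReal_ne_top, ENNReal.toReal_ofReal
      (mul_nonneg (mul_nonneg hmu.le (hd k)) (by positivity)), Real.rpow_neg hx'.le]
  have h1 : d k + ‖x‖ ^ α ≠ 0 := (add_pos_of_nonneg_of_pos (hd k) hp).ne'
  have h2 : mu + mu * d k * (‖x‖ ^ α)⁻¹ ≠ 0 :=
    (add_pos_of_pos_of_nonneg hmu (mul_nonneg (mul_nonneg hmu.le (hd k)) (by positivity))).ne'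
  have key : mu / (mu + mu * d k * (‖x‖ ^ α)⁻¹) = 1 - d k / (d k + ‖x‖ ^ α) := by
    rw [one_sub_div h1, add_sub_cancel_left, div_eq_div_iff h2 h1]
    field_simp
    ring
  rw [key]
  ring

/-- In polar coordinates the integrand is at most 1 on `(0, 1]` and at most `δ y^{1-α}` beyond. -/
lemma integrable_div_add_rpow {δ : ℝ} (hδ : 0 ≤ δ) (hα : 2 < α) :
    Integrable fun x : Plane => δ / (δ + ‖x‖ ^ α) := by
  rw [integrable_fun_norm_addHaar (volume : Measure Plane) (f := fun y => δ / (δ + y ^ α))]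
  simp only [finrank_euclideanSpace_fin, smul_eq_mul, Nat.add_one_sub_one, pow_one]
  have hm : Measurable fun y : ℝ => y * (δ / (δ + y ^ α)) := by fun_prop
  rw [← Ioc_union_Ioi_eq_Ioi (zero_le_one' ℝ)]
  refine IntegrableOn.union ?_ ?_
  · refine Measure.integrableOn_of_bounded (M := 1) (by simp) hm.aestronglyMeasurable ?_
    filter_upwards [ae_restrict_mem measurableSet_Ioc] with y hy
    have hp : 0 < y ^ α := Real.rpow_pos_of_pos hy.1 α
    have h1 : δ / (δ + y ^ α) ≤ 1 := div_le_one_of_le₀ (by linarith) (by linarith)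
    have h0 : 0 ≤ δ / (δ + y ^ α) := by positivity
    rw [Real.norm_of_nonneg (mul_nonneg hy.1.le h0)]
    exact mul_le_one₀ hy.2 h0 h1
  · have hi : IntegrableOn (fun y : ℝ => δ * y ^ (1 - α)) (Ioi 1) :=
      (integrableOn_Ioi_rpow_of_lt (by linarith) one_pos).const_mul δ
    refine hi.mono' hm.aestronglyMeasurable ?_
    filter_upwards [ae_restrict_mem measurableSet_Ioi] with y hy
    have hy0 : (0 : ℝ) < y := one_pos.trans hy
    have hp : 0 < y ^ α := Real.rpow_pos_of_pos hy0 α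
    rw [Real.norm_of_nonneg (by positivity), Real.rpow_sub hy0, Real.rpow_one, mul_div_assoc',
      mul_div_assoc', mul_comm y]
    exact div_le_div_of_nonneg_left (by positivity) hp (by linarith)

lemma setIntegral_div_add_rpow {δ b : ℝ} (hb : 0 ≤ b) :
    ∫ x in {x : Plane | b < ‖x‖}, δ / (δ + ‖x‖ ^ α)
      = 2 * Real.pi * ∫ y in Ioi b, δ / (δ + y ^ α) * y := by
  rw [← integral_indicator (measurableSet_lt_norm b)]
  have h : ({x : Plane | b < ‖x‖}.indicator fun x : Plane => δ / (δ + ‖x‖ ^ α))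
      = fun x => (Ioi b).indicator (fun y => δ / (δ + y ^ α)) ‖x‖ := rfl
  rw [h, integral_norm_plane]
  have h2 : ∀ y, (Ioi b).indicator (fun y => δ / (δ + y ^ α)) y * y
      = (Ioi b).indicator (fun y => δ / (δ + y ^ α) * y) y := fun y =>
    (indicator_mul_left (Ioi b) (fun y => δ / (δ + y ^ α)) fun y => y).symm
  simp_rw [h2]
  rw [setIntegral_indicator measurableSet_Ioi, Ioi_inter_Ioi, max_eq_right hb]

lemma setLIntegral_one_sub_thinLaplace (hmu : 0 < mu) (hα : 2 < α) (hq : ∀ k, 0 ≤ q k)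
    (hq1 : ∑ k, q k = 1) (hd : ∀ k, 0 ≤ d k) {b : ℝ} (hb : 0 ≤ b) :
    ∫⁻ x in {x : Plane | b < ‖x‖}, ENNReal.ofReal (1 - thinLaplace mu α q d x)
      = ENNReal.ofReal
        (∑ k, q k * (2 * Real.pi * ∫ y in Ioi b, d k / (d k + y ^ α) * y)) := by
  have hi : ∀ k, Integrable fun x : Plane => q k * (d k / (d k + ‖x‖ ^ α)) := fun k =>
    (integrable_div_add_rpow (hd k) hα).const_mul _
  rw [setLIntegral_congr_fun (g := fun x => ENNReal.ofReal
      (∑ k, q k * (d k / (d k + ‖x‖ ^ α)))) (measurableSet_lt_norm b) fun x hx => by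
    have hx0 : x ≠ 0 := norm_pos_iff.1 (hb.trans_lt hx)
    beta_reduce
    rw [thinLaplace_eq hmu hq1 hd hx0, sub_sub_cancel],
    ← ofReal_integral_eq_lintegral_ofReal (integrable_finsetSum _ fun k _ => hi k).integrableOn
      (ae_of_all _ fun x => Finset.sum_nonneg fun k _ => mul_nonneg (hq k)
        (div_nonneg (hd k) (add_nonneg (hd k) (by positivity)))),
    integral_finsetSum _ fun k _ => (hi k).integrableOn]
  simp_rw [integral_const_mul, setIntegral_div_add_rpow hb]

/-- The thinning theorem in Laplace form: the exponent is linear in the case probabilities, so it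
splits into one factor per case, with density `lam * q k`. -/
lemma expNeg_setLIntegral_thinLaplace (hmu : 0 < mu) (hα : 2 < α) (hq : ∀ k, 0 ≤ q k)
    (hq1 : ∑ k, q k = 1) (hd : ∀ k, 0 ≤ d k) {b : ℝ} (hb : 0 ≤ b) {lam : ℝ} (hlam : 0 ≤ lam) :
    expNeg (ENNReal.ofReal lam *
        ∫⁻ x in {x : Plane | b < ‖x‖}, ENNReal.ofReal (1 - thinLaplace mu α q d x))
      = ∏ k, Real.exp (-(2 * Real.pi * (lam * q k) * ∫ y in Ioi b, d k / (d k + y ^ α) * y)) := by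
  have h0 : ∀ k, 0 ≤ ∫ y in Ioi b, d k / (d k + y ^ α) * y := fun k =>
    setIntegral_nonneg measurableSet_Ioi fun y hy => by
      have hy0 : 0 < y := hb.trans_lt hy
      exact mul_nonneg (div_nonneg (hd k) (add_nonneg (hd k) (by positivity))) hy0.le
  rw [setLIntegral_one_sub_thinLaplace hmu hα hq hq1 hd hb, ← ENNReal.ofReal_mul hlam,
    expNeg_ofReal (mul_nonneg hlam (Finset.sum_nonneg fun k _ =>
      mul_nonneg (hq k) (mul_nonneg (by positivity) (h0 k)))), ← Real.exp_sum, Finset.mul_sum,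
    ← Finset.sum_neg_distrib]
  congr 1
  refine Finset.sum_congr rfl fun k _ => ?_
  ring

/-- The origin is a null set, so the formulas for `b = 0` cover the whole plane. -/
lemma lintegral_plane_eq (f : Plane → ℝ≥0∞) : ∫⁻ x in {x : Plane | 0 < ‖x‖}, f x = ∫⁻ x, f x := by
  have : {x : Plane | 0 < ‖x‖} = {0}ᶜ := by ext x; simp
  rw [this, restrict_compl_singleton]

/-- The exponent of `thinLaplace` when the gains grow with the distance `a` to the nearest point. -/
noncomputable def thinExponent (mu α : ℝ) (q c : ι → ℝ) (a : ℝ) (x : Plane) : ℝ≥0∞ :=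
  negLog (thinLaplace mu α q (fun k => c k * a ^ α) x)

variable {c : ι → ℝ}

lemma measurable_thinExponent : Measurable (Function.uncurry (thinExponent mu α q c)) := by
  refine measurable_negLog.comp (Finset.measurable_sum _ fun k _ => ?_)
  fun_prop

lemma expNeg_thinExponent (hmu : 0 < mu) (hq : ∀ k, 0 ≤ q k) (hq1 : ∑ k, q k = 1) (a : ℝ)
    (x : Plane) :
    expNeg (thinExponent mu α q c a x) = thinLaplace mu α q (fun k => c k * a ^ α) x :=
  expNeg_negLog (thinLaplace_nonneg hmu hq x) (thinLaplace_le_one hmu hq hq1 x)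

lemma thinExponent_mono (hmu : 0 < mu) (hα : 0 ≤ α) (hq : ∀ k, 0 ≤ q k) (hc : ∀ k, 0 ≤ c k)
    (x : Plane) {a b : ℝ} (ha : 0 ≤ a) (hab : a ≤ b) :
    thinExponent mu α q c a x ≤ thinExponent mu α q c b x :=
  negLog_antitone (thinLaplace_anti hmu hq (fun k =>
    mul_le_mul_of_nonneg_left (Real.rpow_le_rpow ha hab hα) (hc k)) x)

lemma continuousAt_expNeg_thinExponent (hmu : 0 < mu) (hq : ∀ k, 0 ≤ q k) (hq1 : ∑ k, q k = 1)
    (hc : ∀ k, 0 ≤ c k) {x : Plane} (hx : x ≠ 0) {t : ℝ} (ht : 0 < t) :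
    ContinuousAt (fun a => expNeg (thinExponent mu α q c a x)) t := by
  have hr : ContinuousAt (fun a : ℝ => a ^ α) t :=
    Real.continuousAt_rpow_const t α (Or.inl ht.ne')
  have hp : 0 < ‖x‖ ^ α := Real.rpow_pos_of_pos (norm_pos_iff.2 hx) α
  have h : ContinuousAt
      (fun a : ℝ => 1 - ∑ k, q k * (c k * a ^ α / (c k * a ^ α + ‖x‖ ^ α))) t := by
    refine continuousAt_const.sub (tendsto_finsetSum _ fun k _ => ?_)
    refine ContinuousAt.mul continuousAt_const ((continuousAt_const.mul hr).div
      ((continuousAt_const.mul hr).add continuousAt_const) ?_)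
    exact (add_pos_of_nonneg_of_pos (mul_nonneg (hc k) (by positivity)) hp).ne'
  refine h.congr ?_
  filter_upwards [lt_mem_nhds ht] with a ha
  rw [expNeg_thinExponent hmu hq hq1, thinLaplace_eq hmu hq1
    (fun k => mul_nonneg (hc k) (by positivity)) hx]

lemma tailIntegral_thinExponent (hmu : 0 < mu) (hq : ∀ k, 0 ≤ q k) (hq1 : ∑ k, q k = 1)
    (b a : ℝ) :
    tailIntegral (thinExponent mu α q c) b a = ∫⁻ x in {x : Plane | b < ‖x‖},
      ENNReal.ofReal (1 - thinLaplace mu α q (fun k => c k * a ^ α) x) := by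
  simp_rw [tailIntegral, expNeg_thinExponent hmu hq hq1]

lemma tailIntegral_thinExponent_ne_top (hmu : 0 < mu) (hα : 2 < α) (hq : ∀ k, 0 ≤ q k)
    (hq1 : ∑ k, q k = 1) (hc : ∀ k, 0 ≤ c k) {b a : ℝ} (hb : 0 < b) (ha : 0 < a) :
    tailIntegral (thinExponent mu α q c) b a ≠ ∞ := by
  rw [tailIntegral_thinExponent hmu hq hq1, setLIntegral_one_sub_thinLaplace hmu hα hq hq1
    (fun k => mul_nonneg (hc k) (by positivity)) hb.le]
  exact ENNReal.ofReal_ne_top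

end ThinLaplace

/-! ### Gains, case probabilities and the explicit products -/

namespace NetworkParams

variable (p : NetworkParams)

lemma mainGain_pos (i : Node) : 0 < p.mainGain i := by
  have h1 : (1 : ℝ) ≤ p.antennas i := by exact_mod_cast p.one_le_antennas i
  have h2 := mul_nonneg (p.lobeRatio_nonneg i) (sub_nonneg.2 h1)
  exact div_pos (by linarith) (by linarith)

lemma sideGain_nonneg (i : Node) : 0 ≤ p.sideGain i :=
  mul_nonneg (p.lobeRatio_nonneg i) (p.mainGain_pos i).le

lemma linkGain_nonneg (i j : Node) (k : Fin 4) : 0 ≤ p.linkGain i j k := by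
  have h1 := (p.mainGain_pos i).le
  have h2 := (p.mainGain_pos j).le
  have h3 := p.sideGain_nonneg i
  have h4 := p.sideGain_nonneg j
  fin_cases k <;> simp [linkGain] <;> positivity

lemma linkGain_zero (i j : Node) : p.linkGain i j 0 = p.mainGain i * p.mainGain j := rfl

lemma linkGain_zero_pos (i j : Node) : 0 < p.linkGain i j 0 :=
  mul_pos (p.mainGain_pos i) (p.mainGain_pos j)

/-- Probability that an interferer of kind `j` falls into case `k` for a receiver of kind `i`. -/
noncomputable def caseProb (i j : Node) (k : Fin 4) : ℝ := p.thinDensity i j k / p.lam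

lemma caseProb_nonneg (i j : Node) (k : Fin 4) : 0 ≤ p.caseProb i j k := by
  have h1 : (1 : ℝ) ≤ p.antennas i := by exact_mod_cast p.one_le_antennas i
  have h2 : (1 : ℝ) ≤ p.antennas j := by exact_mod_cast p.one_le_antennas j
  have h3 := p.lam_pos
  have h4 : (0 : ℝ) ≤ (p.antennas i : ℝ) - 1 := by linarith
  have h5 : (0 : ℝ) ≤ (p.antennas j : ℝ) - 1 := by linarith
  refine div_nonneg ?_ h3.le
  fin_cases k <;> simp [thinDensity] <;> positivity

lemma sum_caseProb (i j : Node) : ∑ k, p.caseProb i j k = 1 := by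
  have h1 : (1 : ℝ) ≤ p.antennas i := by exact_mod_cast p.one_le_antennas i
  have h2 : (1 : ℝ) ≤ p.antennas j := by exact_mod_cast p.one_le_antennas j
  have h3 := p.lam_pos
  have h4 : (p.antennas i : ℝ) ≠ 0 := by positivity
  have h5 : (p.antennas j : ℝ) ≠ 0 := by positivity
  simp only [caseProb, thinDensity, Fin.sum_univ_four, Matrix.cons_val]
  field_simp
  ring

lemma lam_mul_caseProb (i j : Node) (k : Fin 4) :
    p.lam * p.caseProb i j k = p.thinDensity i j k :=
  mul_div_cancel₀ _ p.lam_pos.ne'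

lemma threshold_nonneg {R : ℝ} (hR : 0 ≤ R) : 0 ≤ threshold R :=
  sub_nonneg.2 (Real.one_le_rpow one_le_two hR)

lemma cRatio_nonneg (k : Fin 4) : 0 ≤ p.cRatio k :=
  div_nonneg (p.linkGain_nonneg _ _ _) (p.linkGain_nonneg _ _ _)

lemma qRatio_nonneg (k : Fin 4) : 0 ≤ p.qRatio k :=
  div_nonneg (p.linkGain_nonneg _ _ _) (p.linkGain_nonneg _ _ _)

lemma sArg_nonneg {R r : ℝ} (hR : 0 ≤ R) (hr : 0 ≤ r) : 0 ≤ p.sArg R r := by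
  have := threshold_nonneg hR
  have h1 := p.mainGain_pos .bs
  have h2 := p.mainGain_pos .user
  have h3 := p.power_pos .bs
  have h4 := p.mu_pos
  unfold sArg
  positivity

/-- Multiplication by `s` divides the gain by that of the serving link and produces the factor `μ`
expected by `thinLaplace`. -/
lemma sArg_mul_bs (R r : ℝ) (k : Fin 4) :
    p.sArg R r * (p.power .bs * p.linkGain .user .bs k)
      = p.mu * (p.cRatio k * threshold R * r ^ p.alpha1) := by
  have h1 := (p.mainGain_pos .bs).ne'
  have h2 := (p.mainGain_pos .user).ne'
  have h3 := (p.power_pos .bs).ne'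
  unfold sArg cRatio
  rw [linkGain_zero]
  field_simp

lemma sArg_mul_user (R r : ℝ) (k : Fin 4) :
    p.sArg R r * (p.power .user * p.linkGain .user .user k)
      = p.mu * ((p.power .user / p.power .bs) * p.qRatio k * threshold R * r ^ p.alpha1) := by
  have h1 := (p.mainGain_pos .bs).ne'
  have h2 := (p.mainGain_pos .user).ne'
  have h3 := (p.power_pos .bs).ne'
  unfold sArg qRatio
  rw [linkGain_zero]
  field_simp

/-- The exponent governing the interference of a base station at `x`, at serving distance `a`. -/
noncomputable def bsExponent (R : ℝ) : ℝ → Plane → ℝ≥0∞ :=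
  thinExponent p.mu p.alpha1 (p.caseProb .user .bs) fun k => p.cRatio k * threshold R

lemma expNeg_tailIntegral_bsExponent {R r : ℝ} (hR : 0 ≤ R) (hr : 0 < r) :
    expNeg (ENNReal.ofReal p.lam * tailIntegral (p.bsExponent R) r r) = p.bsProduct R r := by
  have hT := threshold_nonneg hR
  have hrp : 0 < r ^ p.alpha1 := Real.rpow_pos_of_pos hr _
  rw [bsExponent, tailIntegral_thinExponent p.mu_pos (p.caseProb_nonneg _ _) (p.sum_caseProb _ _),
    expNeg_setLIntegral_thinLaplace p.mu_pos p.two_lt_alpha1 (p.caseProb_nonneg _ _)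
      (p.sum_caseProb _ _) (fun k => mul_nonneg (mul_nonneg (p.cRatio_nonneg k) hT) hrp.le) hr.le
      p.lam_pos.le, bsProduct]
  refine Finset.prod_congr rfl fun k _ => ?_
  rw [lam_mul_caseProb]
  congr 3
  -- Dividing numerator and denominator by `r ^ α₁` turns `c T r^α₁ / (c T r^α₁ + x^α₁)` into the
  -- stated integrand.
  refine setIntegral_congr_fun measurableSet_Ioi fun x hx => ?_
  have hx0 : 0 < x := hr.trans hx
  have hxp : 0 < x ^ p.alpha1 := Real.rpow_pos_of_pos hx0 _
  rw [Real.div_rpow hx0.le hr.le]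
  have h0 := mul_nonneg (p.cRatio_nonneg k) hT
  have h1 : p.cRatio k * threshold R * r ^ p.alpha1 + x ^ p.alpha1 ≠ 0 := by positivity
  have h2 : p.cRatio k * threshold R + x ^ p.alpha1 / r ^ p.alpha1 ≠ 0 := by positivity
  congr 1
  rw [div_eq_div_iff h1 h2]
  field_simp

lemma expNeg_lintegral_user {R r : ℝ} (hR : 0 ≤ R) (hr : 0 < r) :
    expNeg (ENNReal.ofReal p.lam * ∫⁻ x, ENNReal.ofReal (1 - thinLaplace p.mu p.alpha2
        (p.caseProb .user .user)
        (fun k => (p.power .user / p.power .bs) * p.qRatio k * threshold R * r ^ p.alpha1) x))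
      = p.userProduct R r := by
  have hT := threshold_nonneg hR
  have hrp : 0 < r ^ p.alpha1 := Real.rpow_pos_of_pos hr _
  have hP : 0 ≤ p.power .user / p.power .bs := div_nonneg (p.power_pos _).le (p.power_pos _).le
  have hc : ∀ k, 0 ≤ (p.power .user / p.power .bs) * p.qRatio k * threshold R := fun k =>
    mul_nonneg (mul_nonneg hP (p.qRatio_nonneg k)) hT
  rw [← lintegral_plane_eq, expNeg_setLIntegral_thinLaplace p.mu_pos p.two_lt_alpha2
    (p.caseProb_nonneg _ _) (p.sum_caseProb _ _) (fun k => mul_nonneg (hc k) hrp.le) le_rfl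
    p.lam_pos.le, userProduct]
  refine Finset.prod_congr rfl fun k _ => ?_
  rw [lam_mul_caseProb]
  congr 3
  refine setIntegral_congr_fun measurableSet_Ioi fun y hy => ?_
  have hyp : 0 < y ^ p.alpha2 := Real.rpow_pos_of_pos hy _
  have h0 := hc k
  congr 1
  generalize (p.power .user / p.power .bs) * p.qRatio k * threshold R = e at h0 ⊢
  have h1 : e * r ^ p.alpha1 + y ^ p.alpha2 ≠ 0 := by positivity
  have h2 : e + y ^ p.alpha2 / r ^ p.alpha1 ≠ 0 := by positivity
  rw [div_eq_div_iff h1 h2]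
  field_simp

end NetworkParams

/-! ### Interference as a marked sum over one enumeration -/

lemma sum_tsum_subtype_fiber {ι : Type*} [Fintype ι] (κ : ℕ → ι) (Q : ℕ → Prop)
    [DecidablePred Q] {S : ι → ℕ → Prop} (hS : ∀ k j, S k j ↔ κ j = k ∧ Q j)
    (f : ι → ℕ → ℝ≥0∞) :
    ∑ k, ∑' j : {j : ℕ // S k j}, f k j = ∑' j, if Q j then f (κ j) j else 0 := by
  classical
  have h : ∀ k, ∑' j : {j : ℕ // S k j}, f k j
      = ∑' j, if κ j = k ∧ Q j then f k j else 0 := fun k => by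
    rw [← tsum_subtype_eq_of_support_subset (s := {j : ℕ | S k j})
      (f := fun j => if κ j = k ∧ Q j then f k j else 0)]
    · exact tsum_congr fun j => (if_pos ((hS k j).1 j.2)).symm
    · intro j hj
      by_contra h
      exact hj (if_neg fun h' => h ((hS k j).2 h'))
  simp_rw [h]
  rw [← Summable.tsum_finsetSum fun _ _ => ENNReal.summable]
  refine tsum_congr fun j => ?_
  -- Each index belongs to exactly one case, so only `k = κ j` survives.
  rw [Finset.sum_eq_single (κ j)]
  · simp
  · intro k _ hk
    rw [if_neg fun h => hk h.1.symm]
  · simp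

/-- Total weight of the points of `x`, where the point `j` of case `κ j` and fading `g j` has the
weight `v j x (κ j) * g j`. -/
noncomputable def markedSum {ι : Type*} (v : ℕ → (ℕ → Plane) → ι → ℝ≥0∞)
    (z : ((ℕ → Plane) × (ℕ → ι)) × (ℕ → ℝ)) : ℝ≥0∞ :=
  ∑' j, v j z.1.1 (z.1.2 j) * ENNReal.ofReal (z.2 j)

lemma measurable_markedSum {ι : Type*} [MeasurableSpace ι]
    {v : ℕ → (ℕ → Plane) → ι → ℝ≥0∞} (hv : ∀ j, Measurable (Function.uncurry (v j))) :
    Measurable (markedSum v) :=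
  Measurable.tsum fun j => ((hv j).comp (g := Function.uncurry (v j))
    (f := fun z : ((ℕ → Plane) × (ℕ → ι)) × (ℕ → ℝ) => (z.1.1, z.1.2 j)) (by fun_prop)).mul
      (by fun_prop)

namespace NetworkParams

variable (p : NetworkParams)

/-- Weight of the unit fading of base station `j`, which vanishes for the serving one. -/
noncomputable def bsWeight (j : ℕ) (x : ℕ → Plane) (k : Fin 4) : ℝ≥0∞ :=
  if j = nearest x then 0
  else ENNReal.ofReal (p.power .bs * p.linkGain .user .bs k) * ‖x j‖ₑ ^ (-p.alpha1)

lemma bsWeight_of_eq {j : ℕ} {x : ℕ → Plane} (h : j = nearest x) (k : Fin 4) :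
    p.bsWeight j x k = 0 := if_pos h

lemma bsWeight_of_ne {j : ℕ} {x : ℕ → Plane} (h : j ≠ nearest x) (k : Fin 4) :
    p.bsWeight j x k
      = ENNReal.ofReal (p.power .bs * p.linkGain .user .bs k) * ‖x j‖ₑ ^ (-p.alpha1) := if_neg h

/-- Weight of the unit fading of uplink user `j`. -/
noncomputable def userWeight (j : ℕ) (x : ℕ → Plane) (k : Fin 4) : ℝ≥0∞ :=
  ENNReal.ofReal (p.power .user * p.linkGain .user .user k) * ‖x j‖ₑ ^ (-p.alpha2)

lemma measurable_bsWeight (j : ℕ) : Measurable (Function.uncurry (p.bsWeight j)) := by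
  refine measurable_from_prod_countable_left fun k => ?_
  refine Measurable.ite ?_ measurable_const (by fun_prop)
  exact measurableSet_eq_fun measurable_const measurable_nearest

lemma measurable_userWeight (j : ℕ) : Measurable (Function.uncurry (p.userWeight j)) := by
  refine measurable_from_prod_countable_left fun k => ?_
  unfold userWeight
  fun_prop

lemma ofReal_sArg_mul_userWeight {R r : ℝ} (hR : 0 ≤ R) (hr : 0 ≤ r) (j : ℕ) (x : ℕ → Plane)
    (k : Fin 4) :
    ENNReal.ofReal (p.sArg R r) * p.userWeight j x k
      = ENNReal.ofReal (p.mu * ((p.power .user / p.power .bs) * p.qRatio k * threshold R *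
          r ^ p.alpha1)) * ‖x j‖ₑ ^ (-p.alpha2) := by
  rw [userWeight, ← mul_assoc, ← ENNReal.ofReal_mul (p.sArg_nonneg hR hr), sArg_mul_user]

lemma ofReal_sArg_mul_bsWeight {R r : ℝ} (hR : 0 ≤ R) (hr : 0 ≤ r) (j : ℕ) (x : ℕ → Plane)
    (k : Fin 4) :
    ENNReal.ofReal (p.sArg R r) * p.bsWeight j x k
      = if j = nearest x then 0 else ENNReal.ofReal (p.mu * (p.cRatio k * threshold R *
          r ^ p.alpha1)) * ‖x j‖ₑ ^ (-p.alpha1) := by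
  unfold bsWeight
  split_ifs
  · rw [mul_zero]
  · rw [← mul_assoc, ← ENNReal.ofReal_mul (p.sArg_nonneg hR hr), sArg_mul_bs]

end NetworkParams

namespace DownlinkNetwork

variable {Ω : Type*} [MeasurableSpace Ω] {P : Measure Ω} {p : NetworkParams}

/-- Locations, cases and fadings of the base stations. -/
def bsData (N : DownlinkNetwork P p) (ω : Ω) : ((ℕ → Plane) × (ℕ → Fin 4)) × (ℕ → ℝ) :=
  ((fun j => N.bsLoc j ω, fun j => N.bsCase j ω), fun j => N.bsFading j ω)

/-- Locations, cases and fadings of the uplink users. -/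
def userData (N : DownlinkNetwork P p) (ω : Ω) : ((ℕ → Plane) × (ℕ → Fin 4)) × (ℕ → ℝ) :=
  ((fun j => N.userLoc j ω, fun j => N.userCase j ω), fun j => N.userFading j ω)

lemma bsInterference_eq (N : DownlinkNetwork P p) (ω : Ω) :
    N.bsInterference ω = markedSum p.bsWeight (N.bsData ω) := by
  unfold bsInterference markedSum
  rw [sum_tsum_subtype_fiber (fun j => N.bsCase j ω) (fun j => j ≠ N.serving ω)
    (fun _ _ => Iff.rfl) (fun k j => ENNReal.ofReal (p.linkGain .user .bs k * N.bsFading j ω) *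
      ‖N.bsLoc j ω‖ₑ ^ (-p.alpha1)), ← ENNReal.tsum_mul_left]
  refine tsum_congr fun j => ?_
  change _ = p.bsWeight j (fun j => N.bsLoc j ω) (N.bsCase j ω) * ENNReal.ofReal (N.bsFading j ω)
  by_cases hj : j = N.serving ω
  · rw [if_neg (not_not.2 hj), p.bsWeight_of_eq hj, mul_zero, zero_mul]
  · rw [if_pos hj, p.bsWeight_of_ne hj, ENNReal.ofReal_mul (p.linkGain_nonneg _ _ _),
      ENNReal.ofReal_mul (p.power_pos _).le]
    ring

lemma userInterference_eq (N : DownlinkNetwork P p) (ω : Ω) :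
    N.userInterference ω = markedSum p.userWeight (N.userData ω) := by
  unfold userInterference markedSum
  rw [sum_tsum_subtype_fiber (fun j => N.userCase j ω) (fun _ => True)
    (fun _ _ => (and_iff_left trivial).symm)
    (fun k j => ENNReal.ofReal (p.linkGain .user .user k * N.userFading j ω) *
      ‖N.userLoc j ω‖ₑ ^ (-p.alpha2)), ← ENNReal.tsum_mul_left]
  refine tsum_congr fun j => ?_
  rw [if_pos trivial]
  simp only [userData, NetworkParams.userWeight]
  rw [ENNReal.ofReal_mul (p.linkGain_nonneg _ _ _), ENNReal.ofReal_mul (p.power_pos _).le]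
  ring

lemma measurable_bsData (N : DownlinkNetwork P p) : Measurable N.bsData :=
  (N.ppp_bs.measurable_swap.prodMk (measurable_pi_lambda _ N.measurable_bsCase)).prodMk
    (measurable_pi_lambda _ N.measurable_bsFading)

lemma measurable_userData (N : DownlinkNetwork P p) : Measurable N.userData :=
  (N.ppp_user.measurable_swap.prodMk (measurable_pi_lambda _ N.measurable_userCase)).prodMk
    (measurable_pi_lambda _ N.measurable_userFading)

lemma measurable_bsInterference (N : DownlinkNetwork P p) : Measurable N.bsInterference := by
  rw [show N.bsInterference = fun ω => markedSum p.bsWeight (N.bsData ω) from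
    funext N.bsInterference_eq]
  exact (measurable_markedSum p.measurable_bsWeight).comp N.measurable_bsData

lemma measurable_userInterference (N : DownlinkNetwork P p) : Measurable N.userInterference := by
  rw [show N.userInterference = fun ω => markedSum p.userWeight (N.userData ω) from
    funext N.userInterference_eq]
  exact (measurable_markedSum p.measurable_userWeight).comp N.measurable_userData

lemma servingDist_eq (N : DownlinkNetwork P p) :
    N.servingDist = fun ω => nearestDist fun j => N.bsLoc j ω := rfl

lemma measurable_servingDist (N : DownlinkNetwork P p) : Measurable N.servingDist := by
  rw [servingDist_eq]
  exact measurable_nearestDist.comp N.ppp_bs.measurable_swap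

lemma ae_servingDist_pos (N : DownlinkNetwork P p) : ∀ᵐ ω ∂P, 0 < N.servingDist ω :=
  N.ppp_bs.ae_nearestDist_pos

lemma servingDist_nonneg (N : DownlinkNetwork P p) (ω : Ω) : 0 ≤ N.servingDist ω := norm_nonneg _

/-! ### Independence of groups of network variables -/

section Independence

/-- The σ-algebras generated by the seven independent blocks of random variables. -/
@[reducible] def block (N : DownlinkNetwork P p) : Fin 7 → MeasurableSpace Ω :=
  ![MeasurableSpace.comap (fun ω j => N.bsLoc j ω) inferInstance,
    MeasurableSpace.comap (fun ω j => N.userLoc j ω) inferInstance,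
    MeasurableSpace.comap N.fading inferInstance,
    MeasurableSpace.comap (fun ω j => N.bsFading j ω) inferInstance,
    MeasurableSpace.comap (fun ω j => N.userFading j ω) inferInstance,
    MeasurableSpace.comap (fun ω j => N.bsCase j ω) inferInstance,
    MeasurableSpace.comap (fun ω j => N.userCase j ω) inferInstance]

lemma block_le (N : DownlinkNetwork P p) (i : Fin 7) : N.block i ≤ ‹MeasurableSpace Ω› := by
  fin_cases i
  · exact N.ppp_bs.measurable_swap.comap_le
  · exact N.ppp_user.measurable_swap.comap_le
  · exact N.measurable_fading.comap_le
  · exact (measurable_pi_lambda _ N.measurable_bsFading).comap_le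
  · exact (measurable_pi_lambda _ N.measurable_userFading).comap_le
  · exact (measurable_pi_lambda _ N.measurable_bsCase).comap_le
  · exact (measurable_pi_lambda _ N.measurable_userCase).comap_le

/-- Joins over disjoint index sets of an independent family of σ-algebras are independent. The index
sets used below follow the order of the list in `block`. -/
lemma indepFun_of_blocks (N : DownlinkNetwork P p) {β γ : Type*} [mβ : MeasurableSpace β]
    [mγ : MeasurableSpace γ] {A : Ω → β} {B : Ω → γ} (S T : Set (Fin 7)) (hST : Disjoint S T)
    (hA : Measurable[⨆ i ∈ S, N.block i] A) (hB : Measurable[⨆ i ∈ T, N.block i] B) :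
    IndepFun A B P :=
  indep_of_indep_of_le (indep_iSup_of_disjoint N.block_le N.indep hST) hA.comap_le hB.comap_le

lemma measurable_iSup_block (N : DownlinkNetwork P p) {β : Type*} [mβ : MeasurableSpace β]
    {A : Ω → β} {S : Set (Fin 7)} {i : Fin 7} (hi : i ∈ S) (hA : Measurable[N.block i] A) :
    Measurable[⨆ i ∈ S, N.block i] A :=
  hA.mono (le_biSup N.block hi) le_rfl

lemma indepFun_bs (N : DownlinkNetwork P p) :
    IndepFun (fun ω => ((fun j => N.bsLoc j ω), fun j => N.bsCase j ω))
      (fun ω j => N.bsFading j ω) P :=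
  N.indepFun_of_blocks {0, 5} {3} (by simp)
    ((N.measurable_iSup_block (i := 0) (by simp) (comap_measurable _)).prodMk
      (N.measurable_iSup_block (i := 5) (by simp) (comap_measurable _)))
    (N.measurable_iSup_block (i := 3) (by simp) (comap_measurable _))

lemma indepFun_bsLoc_bsCase (N : DownlinkNetwork P p) :
    IndepFun (fun ω j => N.bsLoc j ω) (fun ω j => N.bsCase j ω) P :=
  N.indepFun_of_blocks {0} {5} (by simp)
    (N.measurable_iSup_block (i := 0) (by simp) (comap_measurable _))
    (N.measurable_iSup_block (i := 5) (by simp) (comap_measurable _))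

lemma indepFun_user (N : DownlinkNetwork P p) :
    IndepFun (fun ω => ((fun j => N.userLoc j ω), fun j => N.userCase j ω))
      (fun ω j => N.userFading j ω) P :=
  N.indepFun_of_blocks {1, 6} {4} (by simp)
    ((N.measurable_iSup_block (i := 1) (by simp) (comap_measurable _)).prodMk
      (N.measurable_iSup_block (i := 6) (by simp) (comap_measurable _)))
    (N.measurable_iSup_block (i := 4) (by simp) (comap_measurable _))

lemma indepFun_userLoc_userCase (N : DownlinkNetwork P p) :
    IndepFun (fun ω j => N.userLoc j ω) (fun ω j => N.userCase j ω) P :=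
  N.indepFun_of_blocks {1} {6} (by simp)
    (N.measurable_iSup_block (i := 1) (by simp) (comap_measurable _))
    (N.measurable_iSup_block (i := 6) (by simp) (comap_measurable _))

lemma indepFun_bsData_userData (N : DownlinkNetwork P p) :
    IndepFun N.bsData N.userData P :=
  N.indepFun_of_blocks {0, 3, 5} {1, 4, 6} (by simp [Set.disjoint_left])
    (((N.measurable_iSup_block (i := 0) (by simp) (comap_measurable _)).prodMk
      (N.measurable_iSup_block (i := 5) (by simp) (comap_measurable _))).prodMk
      (N.measurable_iSup_block (i := 3) (by simp) (comap_measurable _)))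
    (((N.measurable_iSup_block (i := 1) (by simp) (comap_measurable _)).prodMk
      (N.measurable_iSup_block (i := 6) (by simp) (comap_measurable _))).prodMk
      (N.measurable_iSup_block (i := 4) (by simp) (comap_measurable _)))

lemma indepFun_data_fading (N : DownlinkNetwork P p) :
    IndepFun (fun ω => (N.bsData ω, N.userData ω)) N.fading P :=
  N.indepFun_of_blocks {0, 1, 3, 4, 5, 6} {2} (by simp)
    ((((N.measurable_iSup_block (i := 0) (by simp) (comap_measurable _)).prodMk
      (N.measurable_iSup_block (i := 5) (by simp) (comap_measurable _))).prodMk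
      (N.measurable_iSup_block (i := 3) (by simp) (comap_measurable _))).prodMk
    (((N.measurable_iSup_block (i := 1) (by simp) (comap_measurable _)).prodMk
      (N.measurable_iSup_block (i := 6) (by simp) (comap_measurable _))).prodMk
      (N.measurable_iSup_block (i := 4) (by simp) (comap_measurable _))))
    (N.measurable_iSup_block (i := 2) (by simp) (comap_measurable _))

end Independence

/-! ### Almost sure finiteness of the interferences -/

section Finiteness

lemma ae_bsInterference_lt_top (N : DownlinkNetwork P p) : ∀ᵐ ω ∂P, N.bsInterference ω < ∞ := by
  have hind : ∀ j, IndepFun (N.bsLoc j) (N.bsFading j) P := fun j =>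
    N.indepFun_bs.comp (φ := fun z : (ℕ → Plane) × (ℕ → Fin 4) => z.1 j)
      (ψ := fun g : ℕ → ℝ => g j) (by fun_prop) (by fun_prop)
  filter_upwards [N.ppp_bs.ae_tsum_fading_lt_top p.mu_pos p.two_lt_alpha1 N.measurable_bsFading
    N.law_bsFading hind] with ω hω
  rw [bsInterference_eq, markedSum]
  -- The gain of each case is bounded by the sum of the four gains, which leaves a multiple of the
  -- unit-gain shot noise.
  refine lt_of_le_of_lt ?_ (ENNReal.mul_lt_top
    (a := ∑ k, ENNReal.ofReal (p.power .bs * p.linkGain .user .bs k))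
    (ENNReal.sum_lt_top.2 fun k _ => ENNReal.ofReal_lt_top) hω)
  rw [← ENNReal.tsum_mul_left]
  refine ENNReal.tsum_le_tsum fun j => ?_
  change p.bsWeight j (fun j => N.bsLoc j ω) (N.bsCase j ω) * ENNReal.ofReal (N.bsFading j ω) ≤ _
  by_cases hj : j = N.serving ω
  · rw [p.bsWeight_of_eq hj, zero_mul]
    exact zero_le
  · rw [p.bsWeight_of_ne hj, mul_assoc, mul_comm (‖N.bsLoc j ω‖ₑ ^ _)]
    exact mul_le_mul_left (Finset.single_le_sum
      (f := fun k => ENNReal.ofReal (p.power .bs * p.linkGain .user .bs k))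
      (fun _ _ => zero_le) (Finset.mem_univ (N.bsCase j ω))) _

lemma ae_userInterference_lt_top (N : DownlinkNetwork P p) :
    ∀ᵐ ω ∂P, N.userInterference ω < ∞ := by
  have hind : ∀ j, IndepFun (N.userLoc j) (N.userFading j) P := fun j =>
    N.indepFun_user.comp (φ := fun z : (ℕ → Plane) × (ℕ → Fin 4) => z.1 j)
      (ψ := fun g : ℕ → ℝ => g j) (by fun_prop) (by fun_prop)
  filter_upwards [N.ppp_user.ae_tsum_fading_lt_top p.mu_pos p.two_lt_alpha2
    N.measurable_userFading N.law_userFading hind] with ω hω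
  rw [userInterference_eq, markedSum]
  refine lt_of_le_of_lt ?_ (ENNReal.mul_lt_top
    (a := ∑ k, ENNReal.ofReal (p.power .user * p.linkGain .user .user k))
    (ENNReal.sum_lt_top.2 fun k _ => ENNReal.ofReal_lt_top) hω)
  rw [← ENNReal.tsum_mul_left]
  refine ENNReal.tsum_le_tsum fun j => ?_
  simp only [userData, NetworkParams.userWeight]
  rw [mul_assoc, mul_comm (‖N.userLoc j ω‖ₑ ^ _)]
  exact mul_le_mul_left (Finset.single_le_sum
    (f := fun k => ENNReal.ofReal (p.power .user * p.linkGain .user .user k))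
    (fun _ _ => zero_le) (Finset.mem_univ (N.userCase j ω))) _

end Finiteness

/-! ### Laplace transforms of the two interferences -/

section Laplace

variable [IsProbabilityMeasure P]

/-- Averaging the marks leaves the Laplace functional of the user process at `negLog (thinLaplace
...)`; `expNeg` undoes `negLog` inside the intensity integral. -/
lemma integral_expNeg_userInterference (N : DownlinkNetwork P p) {R r : ℝ} (hR : 0 ≤ R)
    (hr : 0 < r) :
    ∫ ω, expNeg (ENNReal.ofReal (p.sArg R r) * N.userInterference ω) ∂P = p.userProduct R r := by
  have h := integral_mul_expNeg_marks (P := P) p.mu_pos N.ppp_user.measurable_swap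
    N.measurable_userCase N.measurable_userFading N.indep_userCase N.indep_userFading
    N.law_userFading (p.caseProb_nonneg .user .user)
    N.law_userCase N.indepFun_user N.indepFun_userLoc_userCase
    (u := fun _ => 1) measurable_const (C := 1) (by simp)
    (v := fun j x k => ENNReal.ofReal (p.sArg R r) * p.userWeight j x k)
    (fun j => (p.measurable_userWeight j).const_mul _)
  simp only [one_mul] at h
  have hl : ∀ ω, ENNReal.ofReal (p.sArg R r) * N.userInterference ω
      = ∑' j, ENNReal.ofReal (p.sArg R r) *
        p.userWeight j (fun j => N.userLoc j ω) (N.userCase j ω) *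
          ENNReal.ofReal (N.userFading j ω) := fun ω => by
    rw [userInterference_eq, markedSum, ← ENNReal.tsum_mul_left]
    exact tsum_congr fun j => (mul_assoc _ _ _).symm
  simp_rw [hl]
  rw [h]
  simp_rw [p.ofReal_sArg_mul_userWeight hR hr.le]
  have hL := N.ppp_user.integral_expNeg_tsum (φ := fun x => negLog (thinLaplace p.mu p.alpha2
    (p.caseProb .user .user)
    (fun k => (p.power .user / p.power .bs) * p.qRatio k * NetworkParams.threshold R *
      r ^ p.alpha1) x)) (by unfold thinLaplace; fun_prop)
  simp_rw [expNeg_negLog (thinLaplace_nonneg p.mu_pos (p.caseProb_nonneg _ _) _)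
    (thinLaplace_le_one p.mu_pos (p.caseProb_nonneg _ _) (p.sum_caseProb _ _) _)] at hL
  rw [← p.expNeg_lintegral_user hR hr, ← hL]
  rfl

/-- The law of the serving distance. -/
lemma integral_comp_servingDist (N : DownlinkNetwork P p) {u : ℝ → ℝ} (hu : Measurable u) :
    ∫ ω, u (N.servingDist ω) ∂P
      = ∫ t in Ioi 0, 2 * Real.pi * p.lam * t * voidProb p.lam t * u t := by
  -- With `ψ = 0` the joint law reduces to the law of the nearest distance.
  have h := N.ppp_bs.integral_nearestDist_mul_expNeg p.lam_pos.le (ψ := fun _ _ => 0)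
    measurable_const (fun _ _ _ _ _ => le_rfl) (fun _ _ _ _ => continuousAt_const)
    (fun _ _ _ _ => by simp [tailIntegral]) hu
  rw [servingDist_eq]
  simpa [sumBeyondNearest, nearestDensity, tailIntegral] using h

/-- Both `s` and the serving index are functions of the positions, so averaging the marks with
positions frozen yields `sumBeyondNearest` of `bsExponent`, to which the joint law applies. The test
function `u` carries an indicator for the conditional transform, and the noise and user factors for
the outage. -/
lemma integral_mul_expNeg_bsInterference (N : DownlinkNetwork P p) {R : ℝ} (hR : 0 ≤ R)
    {u : ℝ → ℝ} (hu : Measurable u) {C : ℝ} (hC : ∀ t, ‖u t‖ ≤ C) :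
    ∫ ω, u (N.servingDist ω) *
        expNeg (ENNReal.ofReal (p.sArg R (N.servingDist ω)) * N.bsInterference ω) ∂P
      = ∫ t in Ioi 0, nearestDensity p.lam (p.bsExponent R) t * u t := by
  have hT := NetworkParams.threshold_nonneg hR
  have hs : Measurable (p.sArg R) := by unfold NetworkParams.sArg; fun_prop
  have h := integral_mul_expNeg_marks (P := P) p.mu_pos N.ppp_bs.measurable_swap
    N.measurable_bsCase N.measurable_bsFading N.indep_bsCase N.indep_bsFading
    N.law_bsFading (p.caseProb_nonneg .user .bs)
    N.law_bsCase N.indepFun_bs N.indepFun_bsLoc_bsCase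
    (u := fun x => u (nearestDist x)) (hu.comp measurable_nearestDist) (C := C) (fun _ => hC _)
    (v := fun j x k => ENNReal.ofReal (p.sArg R (nearestDist x)) * p.bsWeight j x k)
    (fun j => (ENNReal.measurable_ofReal.comp (hs.comp
      (measurable_nearestDist.comp measurable_fst))).mul (p.measurable_bsWeight j))
  have hl : ∀ ω, ENNReal.ofReal (p.sArg R (N.servingDist ω)) * N.bsInterference ω
      = ∑' j, ENNReal.ofReal (p.sArg R (nearestDist fun j => N.bsLoc j ω)) *
        p.bsWeight j (fun j => N.bsLoc j ω) (N.bsCase j ω) *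
          ENNReal.ofReal (N.bsFading j ω) := fun ω => by
    rw [bsInterference_eq, markedSum, ← ENNReal.tsum_mul_left]
    exact tsum_congr fun j => (mul_assoc _ _ _).symm
  simp_rw [hl]
  refine Eq.trans h ?_
  have hc : ∀ k, 0 ≤ p.cRatio k * NetworkParams.threshold R := fun k =>
    mul_nonneg (p.cRatio_nonneg k) hT
  rw [← N.ppp_bs.integral_nearestDist_mul_expNeg p.lam_pos.le (ψ := p.bsExponent R)
    measurable_thinExponent
    (fun x a b ha hab => thinExponent_mono p.mu_pos (by linarith [p.two_lt_alpha1])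
      (p.caseProb_nonneg _ _) hc x ha hab)
    (fun x hx t ht => continuousAt_expNeg_thinExponent p.mu_pos (p.caseProb_nonneg _ _)
      (p.sum_caseProb _ _) hc hx ht)
    (fun t a ht ha => tailIntegral_thinExponent_ne_top p.mu_pos p.two_lt_alpha1
      (p.caseProb_nonneg _ _) (p.sum_caseProb _ _) hc ht ha) hu]
  refine integral_congr_ae (ae_of_all _ fun ω => ?_)
  beta_reduce
  rw [mul_comm]
  congr 2
  refine tsum_congr fun j => ?_
  simp_rw [p.ofReal_sArg_mul_bsWeight hR (nearestDist_nonneg _)]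
  split_ifs with hj
  -- The serving station has weight 0, hence Laplace factor 1 and `negLog 1 = 0`, matching the
  -- omitted term.
  · have h1 : ∑ k, p.caseProb .user .bs k * expLaplace p.mu 0 = 1 := by
      simp [expLaplace, p.mu_pos.ne', p.sum_caseProb]
    rw [h1]
    simp [negLog]
  · rfl

end Laplace

end DownlinkNetwork

/-! ### Exponential tails and the outage event -/

lemma measureReal_le_ofReal_expMeasure {mu : ℝ} (hmu : 0 < mu) (c : ℝ≥0∞) :
    (expMeasure mu).real {x | c ≤ ENNReal.ofReal x} = expNeg (ENNReal.ofReal mu * c) := by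
  have := isProbabilityMeasure_expMeasure hmu
  by_cases hc : c = ∞
  · have h : {x : ℝ | c ≤ ENNReal.ofReal x} = ∅ := by
      ext x; simp [hc]
    rw [h, hc, ENNReal.mul_top (by simpa using hmu)]
    simp
  have hm : MeasurableSet {x : ℝ | c ≤ ENNReal.ofReal x} :=
    measurableSet_le measurable_const (by fun_prop)
  have h1 : expMeasure mu {x | c ≤ ENNReal.ofReal x}
      = ∫⁻ x in Ioi c.toReal, ENNReal.ofReal (mu * Real.exp (-mu * x)) := by
    rw [← lintegral_indicator_one hm, lintegral_expMeasure mu (measurable_one.indicator hm),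
      setLIntegral_congr (s := Ioi c.toReal) Ioi_ae_eq_Ici,
      setLIntegral_congr (s := Ioi (0 : ℝ)) Ioi_ae_eq_Ici,
      ← lintegral_indicator measurableSet_Ici, ← lintegral_indicator measurableSet_Ici]
    refine lintegral_congr fun x => ?_
    by_cases hx : 0 ≤ x
    · rw [indicator_of_mem (show x ∈ Ici (0 : ℝ) from hx)]
      have hiff : c ≤ ENNReal.ofReal x ↔ c.toReal ≤ x := ENNReal.le_ofReal_iff_toReal_le hc hx
      by_cases hcx : c.toReal ≤ x
      · rw [indicator_of_mem (show x ∈ {x | c ≤ ENNReal.ofReal x} from hiff.2 hcx),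
          indicator_of_mem (show x ∈ Ici c.toReal from hcx), Pi.one_apply, mul_one, neg_mul]
      · rw [indicator_of_notMem (show x ∉ {x | c ≤ ENNReal.ofReal x} from fun h => hcx (hiff.1 h)),
          indicator_of_notMem (show x ∉ Ici c.toReal from hcx), mul_zero]
    · rw [indicator_of_notMem (show x ∉ Ici (0 : ℝ) from hx), indicator_of_notMem
        (show x ∉ Ici c.toReal from fun h => hx (ENNReal.toReal_nonneg.trans h))]
  have hi : IntegrableOn (fun x => mu * Real.exp (-mu * x)) (Ioi c.toReal) :=
    (exp_neg_integrableOn_Ioi _ hmu).const_mul mu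
  rw [measureReal_def, h1, ← ofReal_integral_eq_lintegral_ofReal hi
    (ae_of_all _ fun x => by positivity), integral_const_mul, integral_exp_mul_Ioi (by linarith),
    neg_div_neg_eq, mul_div_cancel₀ _ hmu.ne', ENNReal.toReal_ofReal (Real.exp_nonneg _),
    expNeg_ofReal_mul hmu.le hc, neg_mul]

/-- The probability that an independent exponential variable is smaller than a random threshold. -/
lemma measureReal_exp_lt {Ω α : Type*} [MeasurableSpace Ω] [MeasurableSpace α] {P : Measure Ω}
    [IsProbabilityMeasure P] {mu : ℝ} (hmu : 0 < mu) {h : Ω → ℝ} (hh : Measurable h)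
    (hlaw : HasLaw h (expMeasure mu) P) {A : Ω → α} (hA : Measurable A) (hind : IndepFun A h P)
    {Y : α → ℝ≥0∞} (hY : Measurable Y) :
    P.real {ω | ENNReal.ofReal (h ω) < Y (A ω)}
      = 1 - ∫ ω, expNeg (ENNReal.ofReal mu * Y (A ω)) ∂P := by
  have hm : MeasurableSet {ω | Y (A ω) ≤ ENNReal.ofReal (h ω)} :=
    measurableSet_le (hY.comp hA) hh.ennreal_ofReal
  have hcompl : {ω | ENNReal.ofReal (h ω) < Y (A ω)} = {ω | Y (A ω) ≤ ENNReal.ofReal (h ω)}ᶜ := by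
    ext ω; simp
  rw [hcompl, probReal_compl_eq_one_sub hm, ← integral_indicator_one hm]
  congr 1
  have hms : MeasurableSet {z : α × ℝ | Y z.1 ≤ ENNReal.ofReal z.2} :=
    measurableSet_le (by fun_prop) (by fun_prop)
  have hi := integral_comp_of_indepFun (P := P) hA hh hind
    (Φ := fun a x => {z : α × ℝ | Y z.1 ≤ ENNReal.ofReal z.2}.indicator (1 : α × ℝ → ℝ) (a, x))
    (C := 1) (measurable_one.indicator hms)
    (fun a x => by
      refine (norm_indicator_le_norm_self _ _).trans ?_
      simp)
  refine Eq.trans hi (integral_congr_ae (ae_of_all _ fun ω => ?_))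
  have hmx : MeasurableSet {x : ℝ | Y (A ω) ≤ ENNReal.ofReal x} :=
    measurableSet_le measurable_const (by fun_prop)
  beta_reduce
  rw [← measureReal_le_ofReal_expMeasure hmu, ← integral_indicator_one hmx]
  exact hlaw.integral_comp (f := {x : ℝ | Y (A ω) ≤ ENNReal.ofReal x}.indicator (1 : ℝ → ℝ))
    (measurable_one.indicator hmx).aestronglyMeasurable

/-- By the choice of the threshold `T`, `R log 2 = log (1 + T)`, and `ENNReal.log` is strictly
increasing. -/
lemma ennreal_log_div_lt_iff {x : ℝ≥0∞} {R : ℝ} (hR : 0 ≤ R) :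
    ENNReal.log (1 + x) / ((Real.log 2 : ℝ) : EReal) < (R : EReal)
      ↔ x < ENNReal.ofReal (NetworkParams.threshold R) := by
  have hlog : (0 : EReal) < ((Real.log 2 : ℝ) : EReal) := by
    exact_mod_cast Real.log_pos one_lt_two
  have hT := NetworkParams.threshold_nonneg hR
  have hexp : ((R : EReal) * ((Real.log 2 : ℝ) : EReal))
      = ENNReal.log (1 + ENNReal.ofReal (NetworkParams.threshold R)) := by
    rw [← EReal.coe_mul, ← EReal.log_exp ((R * Real.log 2 : ℝ) : EReal), EReal.exp_coe,
      ← ENNReal.ofReal_one, ← ENNReal.ofReal_add zero_le_one hT, NetworkParams.threshold,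
      add_sub_cancel, Real.rpow_def_of_pos two_pos, mul_comm R]
  rw [EReal.div_lt_iff hlog (EReal.coe_ne_top _), hexp, ENNReal.log_lt_log_iff,
    ENNReal.add_lt_add_iff_left ENNReal.one_ne_top]

/-! ### The outage integral and the conditional Laplace transform -/

namespace DownlinkNetwork

variable {Ω : Type*} [MeasurableSpace Ω] {P : Measure Ω} {p : NetworkParams}

/-- The SINR inequality is solved for the fading. Positive fading and distance make the numerator
nonzero, so a vanishing denominator gives SINR `∞` and both sides are false. -/
lemma rate_lt_iff (N : DownlinkNetwork P p) {R : ℝ} (hR : 0 ≤ R) {ω : Ω}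
    (hr : 0 < N.servingDist ω) (hh : 0 < N.fading ω) :
    N.rate ω < (R : EReal) ↔ ENNReal.ofReal (N.fading ω)
      < ENNReal.ofReal (p.sArg R (N.servingDist ω) / p.mu) *
        (ENNReal.ofReal p.noise + N.bsInterference ω + N.userInterference ω) := by
  rw [rate, ennreal_log_div_lt_iff hR, sinr]
  generalize ENNReal.ofReal p.noise + N.bsInterference ω + N.userInterference ω = D
  set r := N.servingDist ω
  have hP := p.power_pos .bs
  have hG := p.linkGain_zero_pos .user .bs
  have hK : 0 < p.power .bs * p.linkGain .user .bs 0 * r ^ (-p.alpha1) := by positivity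
  have hnum : ENNReal.ofReal (p.power .bs * p.linkGain .user .bs 0 * N.fading ω) *
      ENNReal.ofReal r ^ (-p.alpha1)
      = ENNReal.ofReal (p.power .bs * p.linkGain .user .bs 0 * r ^ (-p.alpha1)) *
        ENNReal.ofReal (N.fading ω) := by
    rw [ENNReal.ofReal_rpow_of_pos hr, ← ENNReal.ofReal_mul (by positivity),
      ← ENNReal.ofReal_mul hK.le]
    congr 1
    ring
  have hs : NetworkParams.threshold R
      = p.power .bs * p.linkGain .user .bs 0 * r ^ (-p.alpha1) * (p.sArg R r / p.mu) := by
    have h1 := (p.mainGain_pos .bs).ne'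
    have h2 := (p.mainGain_pos .user).ne'
    have h3 := p.mu_pos.ne'
    rw [NetworkParams.sArg, NetworkParams.linkGain_zero, Real.rpow_neg hr.le]
    field_simp
  have hnum0 : ENNReal.ofReal (p.power .bs * p.linkGain .user .bs 0 * r ^ (-p.alpha1)) *
      ENNReal.ofReal (N.fading ω) ≠ 0 := by
    rw [← ENNReal.ofReal_mul hK.le]
    exact (ENNReal.ofReal_pos.2 (mul_pos hK hh)).ne'
  rw [hnum, ENNReal.div_lt_iff (Or.inr hnum0)
    (Or.inr (ENNReal.mul_ne_top ENNReal.ofReal_ne_top ENNReal.ofReal_ne_top)), hs,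
    ENNReal.ofReal_mul hK.le, mul_assoc (ENNReal.ofReal _),
    ENNReal.mul_lt_mul_iff_right (ENNReal.ofReal_pos.2 hK).ne' ENNReal.ofReal_ne_top]

variable [IsProbabilityMeasure P]

lemma outage_eq_one_sub_integral (N : DownlinkNetwork P p) {R : ℝ} (hR : 0 ≤ R) :
    N.outage R = 1 - ∫ ω, expNeg (ENNReal.ofReal (p.sArg R (N.servingDist ω)) *
      (ENNReal.ofReal p.noise + N.bsInterference ω + N.userInterference ω)) ∂P := by
  have hs : Measurable (p.sArg R) := by unfold NetworkParams.sArg; fun_prop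
  have hY : Measurable fun z : (((ℕ → Plane) × (ℕ → Fin 4)) × (ℕ → ℝ)) ×
      (((ℕ → Plane) × (ℕ → Fin 4)) × (ℕ → ℝ)) =>
      ENNReal.ofReal (p.sArg R (nearestDist z.1.1.1) / p.mu) *
        (ENNReal.ofReal p.noise + markedSum p.bsWeight z.1 + markedSum p.userWeight z.2) := by
    have h1 := measurable_markedSum p.measurable_bsWeight
    have h2 := measurable_markedSum p.measurable_userWeight
    have h3 := measurable_nearestDist
    fun_prop
  have h := measureReal_exp_lt p.mu_pos N.measurable_fading N.law_fading
    (N.measurable_bsData.prodMk N.measurable_userData) N.indepFun_data_fading hY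
  simp only [← bsInterference_eq, ← userInterference_eq] at h
  have hd : ∀ ω, nearestDist (N.bsData ω).1.1 = N.servingDist ω := fun ω => rfl
  simp only [hd] at h
  have hmul : ∀ (r : ℝ) (D : ℝ≥0∞), ENNReal.ofReal p.mu *
      (ENNReal.ofReal (p.sArg R r / p.mu) * D) = ENNReal.ofReal (p.sArg R r) * D := by
    intro r D
    rw [← mul_assoc, ← ENNReal.ofReal_mul p.mu_pos.le, mul_div_cancel₀ _ p.mu_pos.ne']
  simp_rw [hmul] at h
  rw [← h, outage]
  refine measureReal_congr ?_
  have hfad : ∀ᵐ ω ∂P, 0 < N.fading ω :=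
    (N.law_fading.ae_iff (p := fun x => 0 < x) (by fun_prop)).2 (ae_pos_expMeasure p.mu)
  filter_upwards [N.ae_servingDist_pos, hfad] with ω h1 h2
  exact propext (N.rate_lt_iff hR h1 h2)

lemma integral_expNeg_noise_add_interference (N : DownlinkNetwork P p) {R : ℝ} (hR : 0 ≤ R) :
    ∫ ω, expNeg (ENNReal.ofReal (p.sArg R (N.servingDist ω)) *
      (ENNReal.ofReal p.noise + N.bsInterference ω + N.userInterference ω)) ∂P
      = 2 * Real.pi * p.lam * ∫ r in Ioi (0 : ℝ),
          r * Real.exp (-p.lam * Real.pi * r ^ 2 - p.sArg R r * p.noise) *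
            p.bsProduct R r * p.userProduct R r := by
  have hs : Measurable (p.sArg R) := by unfold NetworkParams.sArg; fun_prop
  have h1 := measurable_markedSum p.measurable_bsWeight
  have h2 := measurable_markedSum p.measurable_userWeight
  have h3 := measurable_nearestDist
  -- The noise factor times the mean over the users at fixed `r`. It is kept as an integral because
  -- this form is measurable and bounded on all of `ℝ`; the product formula is needed only for `r >
  -- 0`.
  let u : ℝ → ℝ := fun r => expNeg (ENNReal.ofReal (p.sArg R r) * ENNReal.ofReal p.noise) *
    ∫ ω, expNeg (ENNReal.ofReal (p.sArg R r) * N.userInterference ω) ∂P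
  have hint : ∀ r, ‖∫ ω, expNeg (ENNReal.ofReal (p.sArg R r) * N.userInterference ω) ∂P‖ ≤ 1 :=
    fun r => by
      simpa using norm_integral_le_of_norm_le_const (μ := P) (C := 1)
        (ae_of_all _ fun ω => norm_expNeg_le_one
          (ENNReal.ofReal (p.sArg R r) * N.userInterference ω))
  have hum : Measurable u := by
    have hI := N.measurable_userInterference
    have hj : Measurable fun z : ℝ × Ω =>
        expNeg (ENNReal.ofReal (p.sArg R z.1) * N.userInterference z.2) := by fun_prop
    exact Measurable.mul (by fun_prop) hj.stronglyMeasurable.integral_prod_right'.measurable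
  have hu1 : ∀ r, ‖u r‖ ≤ 1 := fun r => by
    rw [norm_mul]
    exact mul_le_one₀ (norm_expNeg_le_one _) (norm_nonneg _) (hint r)
  -- The user data are independent of all base station data, including the distance entering `s`, so
  -- the users can be averaged with that distance frozen.
  have hi := integral_comp_of_indepFun (P := P) N.measurable_bsData N.measurable_userData
    N.indepFun_bsData_userData (Φ := fun z z' =>
      expNeg (ENNReal.ofReal (p.sArg R (nearestDist z.1.1)) *
        (ENNReal.ofReal p.noise + markedSum p.bsWeight z + markedSum p.userWeight z')))
    (C := 1) (by unfold Function.uncurry; fun_prop) (fun _ _ => norm_expNeg_le_one _)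
  simp only [← bsInterference_eq, ← userInterference_eq] at hi
  have hd : ∀ ω, nearestDist (N.bsData ω).1.1 = N.servingDist ω := fun ω => rfl
  simp only [hd] at hi
  have hinner : ∀ ω, ∫ ω', expNeg (ENNReal.ofReal (p.sArg R (N.servingDist ω)) *
      (ENNReal.ofReal p.noise + N.bsInterference ω + N.userInterference ω')) ∂P
      = u (N.servingDist ω) *
        expNeg (ENNReal.ofReal (p.sArg R (N.servingDist ω)) * N.bsInterference ω) := fun ω => by
    simp_rw [mul_add, expNeg_add]
    rw [integral_const_mul]
    ring
  simp_rw [hinner] at hi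
  rw [hi, N.integral_mul_expNeg_bsInterference hR hum hu1, ← integral_const_mul]
  refine setIntegral_congr_fun measurableSet_Ioi fun r hr => ?_
  have hr0 : (0 : ℝ) < r := hr
  have hs0 := p.sArg_nonneg hR hr0.le
  simp only [u]
  rw [N.integral_expNeg_userInterference hR hr0, nearestDensity,
    p.expNeg_tailIntegral_bsExponent hR hr0, ← ENNReal.ofReal_mul hs0,
    expNeg_ofReal (mul_nonneg hs0 p.noise_nonneg), voidProb, sub_eq_add_neg, Real.exp_add]
  have he : Real.exp (-(p.lam * Real.pi * r ^ 2)) = Real.exp (-p.lam * Real.pi * r ^ 2) := by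
    congr 1; ring
  rw [he]
  ring

lemma integral_exp_neg_userInterference (N : DownlinkNetwork P p) {R r : ℝ} (hR : 0 ≤ R)
    (hr : 0 < r) :
    ∫ ω, Real.exp (-(p.sArg R r * (N.userInterference ω).toReal)) ∂P = p.userProduct R r := by
  rw [← N.integral_expNeg_userInterference hR hr]
  refine integral_congr_ae ?_
  filter_upwards [N.ae_userInterference_lt_top] with ω hω
  exact (expNeg_ofReal_mul (p.sArg_nonneg hR hr.le) hω.ne).symm

/-- The conditional expectation is identified by its integrals over the events `{D ∈ A}`: for both
candidates the joint law gives the integral over `A ∩ (0, ∞)` of the same density. -/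
lemma condExp_exp_neg_bsInterference (N : DownlinkNetwork P p) {R : ℝ} (hR : 0 ≤ R) :
    P[fun ω => Real.exp (-(p.sArg R (N.servingDist ω) * (N.bsInterference ω).toReal)) |
        MeasurableSpace.comap N.servingDist inferInstance]
      =ᵐ[P] fun ω => p.bsProduct R (N.servingDist ω) := by
  have hs : Measurable (p.sArg R) := by unfold NetworkParams.sArg; fun_prop
  have hdist := N.measurable_servingDist
  have hI := N.measurable_bsInterference
  -- A version of `bsProduct` that is visibly measurable and bounded by 1; the two agree for `r >
  -- 0`, hence almost surely at the serving distance.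
  let F : ℝ → ℝ := fun r => expNeg (ENNReal.ofReal p.lam * tailIntegral (p.bsExponent R) r r)
  have hF : Measurable F := by
    have := measurable_tailIntegral_diag (ψ := p.bsExponent R) measurable_thinExponent
    fun_prop
  have heq : (fun ω => Real.exp (-(p.sArg R (N.servingDist ω) * (N.bsInterference ω).toReal)))
      =ᵐ[P] fun ω => expNeg (ENNReal.ofReal (p.sArg R (N.servingDist ω)) * N.bsInterference ω) := by
    filter_upwards [N.ae_bsInterference_lt_top] with ω hω
    exact (expNeg_ofReal_mul (p.sArg_nonneg hR (N.servingDist_nonneg ω)) hω.ne).symm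
  have hFint : Integrable (fun ω => F (N.servingDist ω)) P :=
    Integrable.of_bound (hF.comp hdist).aestronglyMeasurable 1
      (ae_of_all _ fun _ => norm_expNeg_le_one _)
  refine (condExp_congr_ae heq).trans (EventuallyEq.trans
    (ae_eq_condExp_of_forall_setIntegral_eq (g := fun ω => F (N.servingDist ω)) hdist.comap_le
      (integrable_expNeg (by fun_prop)) (fun _ _ _ => hFint.integrableOn) ?_ ?_).symm ?_)
  · rintro _ ⟨A, hA, rfl⟩ -
    have hind : ∀ (f : Ω → ℝ) (ω : Ω), (N.servingDist ⁻¹' A).indicator f ω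
        = A.indicator 1 (N.servingDist ω) * f ω := fun f ω => by
      by_cases h : N.servingDist ω ∈ A
      · rw [indicator_of_mem (show ω ∈ N.servingDist ⁻¹' A from h), indicator_of_mem h,
          Pi.one_apply, one_mul]
      · rw [indicator_of_notMem (show ω ∉ N.servingDist ⁻¹' A from h), indicator_of_notMem h,
          zero_mul]
    have hA1 : Measurable (A.indicator (1 : ℝ → ℝ)) := measurable_one.indicator hA
    rw [← integral_indicator (hdist hA), ← integral_indicator (hdist hA)]
    simp_rw [hind]
    rw [N.integral_mul_expNeg_bsInterference hR hA1 (C := 1) (fun t => by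
        refine (norm_indicator_le_norm_self _ _).trans ?_
        simp), N.integral_comp_servingDist (u := fun t => A.indicator 1 t * F t) (hA1.mul hF)]
    refine setIntegral_congr_fun measurableSet_Ioi fun t _ => ?_
    simp only [nearestDensity, F]
    ring
  · exact ((hF.comp (comap_measurable N.servingDist)).stronglyMeasurable).aestronglyMeasurable
  · filter_upwards [N.ae_servingDist_pos] with ω hω
    exact p.expNeg_tailIntegral_bsExponent hR hω

end DownlinkNetwork

/-- Outage probability of the downlink user. The first two conjuncts say that the interferences
are finite random variables and that the two explicit products are their Laplace transforms at
`s`, the one of the base station interference being conditional on the serving distance. -/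
theorem theorem2 {Ω : Type*} [MeasurableSpace Ω] (P : Measure Ω) [IsProbabilityMeasure P]
    (p : NetworkParams) (N : DownlinkNetwork P p) (R : ℝ) (hR : 0 ≤ R) :
    (∀ᵐ ω ∂P, N.bsInterference ω < ∞ ∧ N.userInterference ω < ∞) ∧
    ((P[fun ω => Real.exp (-(p.sArg R (N.servingDist ω) * (N.bsInterference ω).toReal)) |
          MeasurableSpace.comap N.servingDist inferInstance]
        =ᵐ[P] fun ω => p.bsProduct R (N.servingDist ω)) ∧
      ∀ r : ℝ, 0 < r →
        ∫ ω, Real.exp (-(p.sArg R r * (N.userInterference ω).toReal)) ∂P = p.userProduct R r) ∧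
    N.outage R =
      1 - 2 * Real.pi * p.lam *
        ∫ r in Ioi (0 : ℝ),
          r * Real.exp (-p.lam * Real.pi * r ^ 2 - p.sArg R r * p.noise) *
            p.bsProduct R r * p.userProduct R r := by
  refine ⟨N.ae_bsInterference_lt_top.and N.ae_userInterference_lt_top,
    ⟨N.condExp_exp_neg_bsInterference hR,
      fun r hr => N.integral_exp_neg_userInterference hR hr⟩, ?_⟩
  rw [N.outage_eq_one_sub_integral hR, N.integral_expNeg_noise_add_interference hR]
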